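/- **Setting.** Let $K$ be a field of characteristic $0$ (for instance $\mathbb{C}$). Let $G$ be a finite connected directed plane graph (loops and multiple edges allowed) in which any two distinct bounded faces share at most one edge. Fix linear orders on the edges and on the bounded faces. For a bounded face $F$ and an edge $e$ let $\varepsilon_{F,e}$ be $1$ (resp. $-1$) if $e$ lies on the boundary cycle of $F$ and points clockwise (resp. counterclockwise) around $F$, and $0$ if $e$ is not on the boundary cycle of $F$ (in particular if $F$ lies on both sides of $e$). For edge labels $(x+a_ey)^2$ with $a=(a_e)_e\in K^{E(G)}$, the extended cycle basis matrix $M^{\mathsf{ext}}_G(a)$ has one column for each edge $e$ and, for each bounded face $F$, three rows with entries $\varepsilon_{F,e}a_e^t$, $t=0,1,2$. The labels $a$ are *in special position* for $G$ if $\operatorname{rank} M^{\mathsf{ext}}_G(a)<\max_b \operatorname{rank} M^{\mathsf{ext}}_G(b)$. For a set $S$ of bounded faces, $G_S$ is the subgraph of all vertices and edges on faces in $S$, with $S$ as its set of faces; write $e_S$ and $f_S=|S|$ for its numbers of edges and faces. The contraction $G\backslash G_S$ has edges $E(G)\setminus E(G_S)$ and faces those not in $S$, the two ends of every edge of $G_S$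 being identified. A nonempty $S$ is *contractible* if $e_S\le 3f_S$, and *minimal contractible* if moreover no nonempty proper subset of $S$ is contractible. The same notions are used for graphs obtained from $G$ by contractions and for the subgraphs $G_S$ of such graphs, and special position for such a graph is regarded as a condition on $a\in K^{E(G)}$ that depends only on the labels of its edges. For a graph $H$ with face set $\mathcal F$ and a set $C$ of edges of $H$, an *edge-injective function* with values in $C$ assigns to each $F\in\mathcal F$ a set $\varphi(F)\subseteq C$ of three edges on the boundary of $F$, such that $\varphi(F)\cap\varphi(F')=\emptyset$ for $F\ne F'$. Let $N_{F,\varphi(F)}$ be the $3\times3$ matrix $(\varepsilon_{F,e}a_e^t)_{t,\,e}$, $t=0,1,2$, $e\in\varphi(F)$ in increasing order; its determinant is, up to sign, a Vandermonde determinant. Let $\operatorname{sgn}(\varphi)$ be $-1$ to the number of pairs of faces $F<F'$ with edges $e\in\varphi(F)$, $e'\in\varphi(F')$, $e'<e$. Put $$p_{H,C}=\sum_{\varphi}\operatorname{sgn}(\varphi)\prod_{F\in\mathcal F}\det N_{F,\varphi(F)}\in K[a_e : e\in E(G)],$$ the sum being over all edge-injective functions on $H$ with values in $C$. **Theorem.**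 Let $k\ge0$, $G'_1=G$, and for $i=1,\dots,k$ let $S_i$ be a minimal contractible set of faces of $G'_i$ and $G'_{i+1}=G'_i\backslash G_{S_i}$, where $G_{S_i}$ is formed in $G'_i$. Assume that $G'_{k+1}$ has no contractible proper subset of its set of faces, and that within each $G'_i$, $1\le i\le k+1$, no two distinct minimal contractible sets of faces have subgraphs that share an edge. Then: 1. For $i\le k$, $a$ is in special position for $G_{S_i}$ if and only if $\operatorname{rank}M^{\mathsf{ext}}_{G_{S_i}}(a)<e_{G_{S_i}}$, and the set $\mathcal V_i$ of such $a$ is an algebraic variety. Likewise, $a$ is in special position for $G'_{k+1}$ if and only if $\operatorname{rank}M^{\mathsf{ext}}_{G'_{k+1}}(a)<\min(e,3f)$, where $f$ is the number of faces of $G'_{k+1}$ and $e$ the number of its edges on the boundary of some face, and the set $\mathcal V_{k+1}$ of such $a$ is an algebraic variety. 2. The union $\bigcup_{i=1}^{k+1}\mathcal V_i$ is an algebraic variety, and it is the locus of edge labels in special position for $G$. 3. For $i\le k$ one of the following holds: * $e_{G_{S_i}}-3f_{G_{S_i}}=-2$, $G_{S_i}$ has a single edge, and $\mathcal V_i=\emptyset$;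 * $e_{G_{S_i}}-3f_{G_{S_i}}=-1$, $G_{S_i}$ has exactly two edges $e_j,e_{j'}$, and $\mathcal V_i$ is the hypersurface $a_j-a_{j'}=0$; * $e_{G_{S_i}}-3f_{G_{S_i}}=0$, the polynomial $p_{G_{S_i},E(G_{S_i})}$ is nonzero, and $\mathcal V_i$ is the hypersurface on which it vanishes. 4. If $e\ge3f$ (with $e,f$ as in 1), then $\mathcal V_{k+1}=\bigcap_C\{a: p_{G'_{k+1},C}(a)=0\}$, where $C$ runs over all sets of $3f$ edges of $G'_{k+1}$. -/

import Mathlib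

/-- A finite connected directed plane graph (loops and multiple edges allowed), given by its
rotation system. A dart is a pair `(e, b)`: the edge `e` traversed along its direction (`b = true`)
or against it (`b = false`). `rot` sends a dart to the next dart, counterclockwise, with the same
source, so the vertices are the orbits of `rot`. `side d` is the face to the right of `d`, that is,
the face around which `d` points clockwise; `none` is the unbounded face and the elements of `F` are
the bounded faces. The faces are the orbits of "arrive at the end of `d`, then turn to the next
dart". Euler's formula says that the surface is the sphere. -/
structure PlaneGraph (V E F : Type*) [Fintype V] [Fintype E] [Fintype F] where
  src : E × Bool → V
  rot : Equiv.Perm (E × Bool)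
  rot_orbit : ∀ d d', rot.SameCycle d d' ↔ src d = src d'
  side : E × Bool → Option F
  side_orbit : ∀ d d',
    Equiv.Perm.SameCycle (((Equiv.refl E).prodCongr Equiv.boolNot).trans rot) d d' ↔
      side d = side d'
  side_surjective : Nonempty E → Function.Surjective side
  nonempty : Nonempty V
  connected : ∀ u v : V,
    Relation.ReflTransGen (fun x y => ∃ e b, src (e, b) = x ∧ src (e, !b) = y) u v
  euler : Fintype.card V + (Fintype.card F + 1) = Fintype.card E + 2

namespace PlaneGraph

variable {V E F : Type*} [Fintype V] [Fintype E] [Fintype F]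

open scoped Classical in
/-- The entry of the cycle basis matrix: `1` if `e` is on the boundary of `f` and points clockwise
around `f`, `-1` if it points counterclockwise, `0` if `e` is not on the boundary cycle of `f`
(in particular if `f` is on both sides of `e`). -/
noncomputable def bd (G : PlaneGraph V E F) (f : F) (e : E) : ℤ :=
  (if G.side (e, true) = some f then 1 else 0) - (if G.side (e, false) = some f then 1 else 0)

/-- Any two distinct bounded faces share at most one edge. -/
def ShareAtMostOneEdge (G : PlaneGraph V E F) : Prop :=
  ∀ f f' : F, f ≠ f' → ∀ e e' : E,
    G.bd f e ≠ 0 → G.bd f' e ≠ 0 → G.bd f e' ≠ 0 → G.bd f' e' ≠ 0 → e = e'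

/-- A graph with marked bounded faces, obtained from `G` by contracting subgraphs and passing to
subgraphs: its vertices are the classes under `glue` of the elements of `verts`, and the edges and
faces are those in `edges` and `faces`. The boundary of a face consists of those of its edges in `G`
that are still present, with the same orientation. -/
structure Minor (G : PlaneGraph V E F) where
  verts : Set V
  glue : Setoid V
  edges : Finset E
  faces : Finset F

/-- `G` itself, with all its bounded faces. -/
def whole (G : PlaneGraph V E F) : G.Minor where
  verts := Set.univ
  glue := ⊥
  edges := Finset.univ
  faces := Finset.univ

namespace Minor

variable {G : PlaneGraph V E F}

open scoped Classical in
/-- The edges on the boundary of some face in `S`. -/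
noncomputable def edgesOn (H : G.Minor) (S : Finset F) : Finset E :=
  H.edges.filter (fun e => ∃ f ∈ S, G.bd f e ≠ 0)

/-- The subgraph `H_S`: all vertices and edges on any face in `S`, with `S` as its faces. -/
noncomputable def sub (H : G.Minor) (S : Finset F) : G.Minor where
  verts := {v | v ∈ H.verts ∧ ∃ e ∈ H.edgesOn S, ∃ b, H.glue v (G.src (e, b))}
  glue := H.glue
  edges := H.edgesOn S
  faces := S

open scoped Classical in
/-- The contraction of `H` along `H_S`: the edges and faces of `H_S` are removed, and the two ends
of each removed edge are identified. -/
noncomputable def contract (H : G.Minor) (S : Finset F) : G.Minor where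
  verts := H.verts
  glue := H.glue ⊔ Relation.EqvGen.setoid
    (fun u v => ∃ e ∈ H.edgesOn S, u = G.src (e, true) ∧ v = G.src (e, false))
  edges := H.edges \ H.edgesOn S
  faces := H.faces \ S

/-- The result of contracting successively along `S 0, …, S (n - 1)`. -/
noncomputable def contractSeq (H : G.Minor) (S : ℕ → Finset F) : ℕ → G.Minor
  | 0 => H
  | n + 1 => (contractSeq H S n).contract (S n)

/-- `S` is a contractible set of faces: nonempty, with `e_S ≤ 3 f_S`. -/
def IsContractible (H : G.Minor) (S : Finset F) : Prop :=
  S ⊆ H.faces ∧ S.Nonempty ∧ (H.edgesOn S).card ≤ 3 * S.card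

/-- `S` is contractible and no proper subset of it is. -/
def IsMinimalContractible (H : G.Minor) (S : Finset F) : Prop :=
  H.IsContractible S ∧ ∀ T, T ⊂ S → ¬ H.IsContractible T

/-- The extended cycle basis matrix for the edge labels `(x + a e * y) ^ 2`. -/
noncomputable def Mext {K : Type*} [Field K] (H : G.Minor) (a : E → K) :
    Matrix (H.faces × Fin 3) H.edges K :=
  fun r e => (G.bd r.1 e : K) * a e ^ (r.2 : ℕ)

/-- The edge labels are in special position for `H` if the rank of the extended cycle basis matrix
is smaller than expected, i.e. smaller than the largest rank over all choices of labels. -/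
def InSpecialPosition {K : Type*} [Field K] (H : G.Minor) (a : E → K) : Prop :=
  ∃ b : E → K, (H.Mext a).rank < (H.Mext b).rank

/-- The locus of edge labels in special position for `H`. -/
def specialLocus (K : Type*) [Field K] (H : G.Minor) : Set (E → K) :=
  {a | H.InSpecialPosition a}

variable [LinearOrder E]

/-- A map `φ` from faces to unordered triples of edges is edge-injective with values in the edge set
`C`: every `φ f` consists of edges in `C` on the boundary of `f`, and different faces get disjoint
triples. -/
def IsEdgeInjective (H : G.Minor) (C : Finset E) (φ : H.faces → {A : Finset E // A.card = 3}) :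
    Prop :=
  (∀ f, ∀ e ∈ (φ f).1, e ∈ C ∧ G.bd f e ≠ 0) ∧
    ∀ f f', f ≠ f' → Disjoint (φ f).1 (φ f').1

/-- The `3 × 3` matrix with the three rows of the face `f` and the columns of the edges in `A`, in
increasing order, the labels being indeterminates. -/
noncomputable def faceMatrix (K : Type*) [Field K] (G : PlaneGraph V E F) (f : F)
    (A : {A : Finset E // A.card = 3}) : Matrix (Fin 3) (Fin 3) (MvPolynomial E K) :=
  fun t j => (G.bd f (A.1.orderEmbOfFin A.2 j) : MvPolynomial E K) *
    MvPolynomial.X (A.1.orderEmbOfFin A.2 j) ^ (t : ℕ)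

variable [LinearOrder F]

/-- The sign of the permutation that lists the edges of `φ f`, in increasing order, face after
face: `(-1)` to the number of pairs of faces `f < f'` with edges `e ∈ φ f`, `e' ∈ φ f'`, `e' < e`. -/
noncomputable def shuffleSign (H : G.Minor) (φ : H.faces → {A : Finset E // A.card = 3}) : ℤ :=
  (-1) ^ (Finset.univ.filter (fun p : (H.faces × E) × (H.faces × E) =>
    p.1.2 ∈ (φ p.1.1).1 ∧ p.2.2 ∈ (φ p.2.1).1 ∧ p.1.1 < p.2.1 ∧ p.2.2 < p.1.2)).card

open scoped Classical in
/-- The sum, over all edge-injective functions `φ` with values in `C`, of the signed products of the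
determinants of the matrices of the faces `f` with columns `φ f`. -/
noncomputable def edgeInjectivePoly (K : Type*) [Field K] (H : G.Minor) (C : Finset E) :
    MvPolynomial E K :=
  ∑ φ ∈ Finset.univ.filter (H.IsEdgeInjective C),
    (H.shuffleSign φ : MvPolynomial E K) * ∏ f : H.faces, (faceMatrix K G f (φ f)).det

end Minor

end PlaneGraph

/-- The set of zeros of a polynomial. -/
def polyZeros {E K : Type*} [Field K] (p : MvPolynomial E K) : Set (E → K) :=
  {a | MvPolynomial.eval a p = 0}

/-- The set of common zeros of a set of polynomials. -/
def IsAlgebraicVariety {E K : Type*} [Field K] (Z : Set (E → K)) : Prop :=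
  ∃ P : Set (MvPolynomial E K), Z = ⋂ p ∈ P, polyZeros p

namespace PlaneGraph

/-! ### Exactness of boundary and coboundary over ℚ -/

section Planarity

variable {V E F : Type*} [Fintype V] [Fintype E] [Fintype F]

/-! Along the contractions the extended cycle basis matrix is block triangular: the rows of `S i`
vanish in the columns that survive the contraction of `S i`. So the ranks of the diagonal blocks add
up to a lower bound for the total rank (`add_rank_succ_le`), and labels for which no block is
deficient are not special for `G`.

The converse needs that a deficient block cannot be compensated by the entries which the rows of `S
l` have in columns removed earlier. If `S l` has three edges per face, its number of rows is already
the expected rank. Otherwise it is a single face with one or two edges (`card_eq_or_singleton`), and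
such a face has not lost any edge before (`edgesAt_eq_of_card_le_two`), so there are no further
entries. A last graph with fewer than three edges per face is treated as one more contraction
(`extend`).

These facts rest on planar edge counts. Euler's formula identifies the chains with zero boundary
with the cuts (`ker_boundary`). Since two faces share at most one edge, the relevant cuts have at
least three edges, and a dimension count gives the bounds known for simple planar graphs
(`card_shared_add_three_le`, `card_add_three_le`). The second one requires that no set of remaining
faces is cut off from the unbounded face; this is `not_isClosedIn`, which uses that distinct minimal
contractible sets share no edge.

That each block attains its expected rank follows from Rado's theorem, applied to the sets of
columns that an edge yields as its label varies; Rado's condition is again a planar count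
(`exists_rank_labelMatrix_ge`). The explicit polynomials are maximal minors, expanded by Laplace
along the three rows of each face (`det_eq_sum_triples`). -/

lemma sum_mul_bd {R : Type*} [CommRing R] (G : PlaneGraph V E F) (y : F → R) (e : E) :
    ∑ f, y f * (G.bd f e : R) =
      (G.side (e, true)).elim 0 y - (G.side (e, false)).elim 0 y := by
  classical
  have key : ∀ o : Option F, ∑ f, y f * (if o = some f then 1 else 0) = o.elim 0 y := by
    intro o
    cases o with
    | none => simp
    | some g => simp
  have : ∀ f, y f * (G.bd f e : R) = y f * (if G.side (e, true) = some f then 1 else 0) -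
      y f * (if G.side (e, false) = some f then 1 else 0) := by
    intro f
    unfold bd
    push_cast
    rw [mul_sub]
  simp only [this, Finset.sum_sub_distrib, key]

/-- The coboundary of a function on the vertices. -/
def coboundary (G : PlaneGraph V E F) : (V → ℚ) →ₗ[ℚ] (E → ℚ) where
  toFun x e := x (G.src (e, false)) - x (G.src (e, true))
  map_add' x y := by ext e; simp; ring
  map_smul' c x := by ext e; simp; ring

/-- The boundary, in the dual graph, of a chain of edges. -/
noncomputable def boundary (G : PlaneGraph V E F) : (E → ℚ) →ₗ[ℚ] (F → ℚ) where
  toFun z f := ∑ e, (G.bd f e : ℚ) * z e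
  map_add' x y := by ext e; simp [mul_add, Finset.sum_add_distrib]
  map_smul' c x := by
    ext e; simp only [Pi.smul_apply, smul_eq_mul, RingHom.id_apply, Finset.mul_sum]
    exact Finset.sum_congr rfl fun _ _ => by ring

lemma coboundary_apply (G : PlaneGraph V E F) (x : V → ℚ) (e : E) :
    G.coboundary x e = x (G.src (e, false)) - x (G.src (e, true)) := rfl

lemma boundary_apply (G : PlaneGraph V E F) (z : E → ℚ) (f : F) :
    G.boundary z f = ∑ e, (G.bd f e : ℚ) * z e := rfl

/-- Around a face every dart ends where the next one starts, so the differences telescope. -/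
lemma boundary_coboundary (G : PlaneGraph V E F) (x : V → ℚ) :
    G.boundary (G.coboundary x) = 0 := by
  classical
  ext f
  let nx : Equiv.Perm (E × Bool) :=
    ((Equiv.refl E).prodCongr Equiv.boolNot).trans G.rot
  let ind : E × Bool → ℚ := fun d => if G.side d = some f then 1 else 0
  have hside : ∀ d, G.side (nx d) = G.side d := fun d =>
    ((G.side_orbit d (nx d)).1 ⟨1, by simp [nx]⟩).symm
  have hsrc : ∀ e b, G.src (nx (e, b)) = G.src (e, !b) := fun e b =>
    ((G.rot_orbit (e, !b) (nx (e, b))).1 ⟨1, by simp [nx]⟩).symm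
  have h1 : ∑ d, ind d * x (G.src (nx d)) = ∑ d, ind d * x (G.src d) := by
    rw [← Equiv.sum_comp nx (fun d => ind d * x (G.src d))]
    exact Finset.sum_congr rfl fun d _ => by simp only [ind, hside]
  have h2 : G.boundary (G.coboundary x) f =
      ∑ d, ind d * x (G.src (nx d)) - ∑ d, ind d * x (G.src d) := by
    rw [boundary_apply, ← Finset.sum_sub_distrib, Fintype.sum_prod_type]
    refine Finset.sum_congr rfl fun e _ => ?_
    rw [Fintype.sum_bool, hsrc, hsrc, coboundary_apply]
    simp only [bd, ind, Bool.not_true, Bool.not_false]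
    push_cast
    ring
  rw [h2, h1, sub_self]; rfl

lemma eq_of_coboundary_eq_zero (G : PlaneGraph V E F) {x : V → ℚ} (h : G.coboundary x = 0)
    (u v : V) : x u = x v := by
  induction G.connected u v with
  | refl => rfl
  | tail _ hs ih =>
    obtain ⟨e, b, h1, h2⟩ := hs
    rw [ih, ← h1, ← h2]
    have := congrFun h e
    rw [coboundary_apply] at this
    cases b <;> simp at this ⊢ <;> linarith

/-- The value passes unchanged across each edge, hence to all darts at a vertex by rotation, and to
all darts by connectedness. The unbounded face carries the value 0. -/
lemma eq_zero_of_side_invariant (G : PlaneGraph V E F) {R : Type*} [CommRing R] {y : F → R}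
    (h : ∀ e, (G.side (e, true)).elim 0 y = (G.side (e, false)).elim 0 y) : y = 0 := by
  classical
  let Y : E × Bool → R := fun d => (G.side d).elim 0 y
  have hrev : ∀ e b, Y (e, !b) = Y (e, b) := by
    intro e b
    cases b
    · exact h e
    · exact (h e).symm
  have hrot : ∀ d, Y (G.rot d) = Y d := by
    rintro ⟨e, b⟩
    have : G.side (e, !b) = G.side (G.rot (e, b)) :=
      (G.side_orbit _ _).1 ⟨1, by simp⟩
    rw [← hrev e b]
    simp only [Y, this]
  have hcyc : ∀ d d', G.src d = G.src d' → Y d = Y d' := by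
    intro d d' hd
    obtain ⟨n, hn⟩ := ((G.rot_orbit d d').2 hd).exists_nat_pow_eq
    rw [← hn]
    clear hn
    induction n with
    | zero => rfl
    | succ n ih => rw [pow_succ', Equiv.Perm.mul_apply, hrot, ih]
  have hall : ∀ u v, ∀ d d', G.src d = u → G.src d' = v → Y d = Y d' := by
    intro u v
    induction G.connected u v with
    | refl => intro d d' h1 h2; exact hcyc d d' (h1.trans h2.symm)
    | tail _ hs ih =>
      obtain ⟨e, b, h1, h2⟩ := hs
      intro d d' h3 h4
      rw [ih d (e, b) h3 h1, ← hrev e b]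
      exact hcyc _ _ (h2.trans h4.symm)
  ext f
  by_cases hE : Nonempty E
  · obtain ⟨d, hd⟩ := G.side_surjective hE (some f)
    obtain ⟨d', hd'⟩ := G.side_surjective hE none
    have := hall _ _ d d' rfl rfl
    simpa [Y, hd, hd'] using this
  -- Without edges, Euler's formula leaves no room for a bounded face.
  · rw [not_nonempty_iff] at hE
    have h1 := G.euler
    have h2 : 0 < Fintype.card V := Fintype.card_pos_iff.2 G.nonempty
    have h3 : 0 < Fintype.card F := Fintype.card_pos_iff.2 ⟨f⟩
    rw [Fintype.card_eq_zero (α := E)] at h1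
    omega

/-- A functional that kills the image is a function on the faces that agrees across every edge. -/
lemma boundary_surjective (G : PlaneGraph V E F) : Function.Surjective G.boundary := by
  classical
  rw [← LinearMap.dualMap_injective_iff, injective_iff_map_eq_zero]
  intro φ hφ
  have hy : (fun f => φ (Pi.single f 1)) = 0 := by
    apply G.eq_zero_of_side_invariant
    intro e
    rw [← sub_eq_zero, ← sum_mul_bd]
    have := LinearMap.congr_fun hφ (Pi.single e 1)
    rw [LinearMap.dualMap_apply] at this
    have h2 : G.boundary (Pi.single e 1) = ∑ f, (G.bd f e : ℚ) • Pi.single f (1 : ℚ) := by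
      ext f
      simp [boundary_apply, Pi.single_apply]
    rw [h2, map_sum] at this
    simpa [mul_comm] using this
  refine LinearMap.pi_ext' fun f => LinearMap.ext_ring ?_
  simpa using congrFun hy f

/-- One inclusion is `boundary_coboundary`. The dimensions are |E| - |F| and |V| - 1, which are
equal by Euler's formula. -/
lemma ker_boundary (G : PlaneGraph V E F) :
    LinearMap.ker G.boundary = LinearMap.range G.coboundary := by
  classical
  symm
  apply Submodule.eq_of_le_of_finrank_eq
  · rintro _ ⟨x, rfl⟩
    exact G.boundary_coboundary x
  · have h1 := LinearMap.finrank_range_add_finrank_ker G.boundary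
    have h2 := LinearMap.finrank_range_add_finrank_ker G.coboundary
    have h3 : Module.finrank ℚ (LinearMap.ker G.coboundary) = 1 := by
      obtain ⟨v⟩ := G.nonempty
      have : LinearMap.ker G.coboundary = Submodule.span ℚ {fun _ => (1 : ℚ)} := by
        ext x
        rw [LinearMap.mem_ker, Submodule.mem_span_singleton]
        constructor
        · intro hx
          exact ⟨x v, funext fun u => by simp [G.eq_of_coboundary_eq_zero hx u v]⟩
        · rintro ⟨c, rfl⟩
          ext e
          simp [coboundary_apply]
      rw [this, finrank_span_singleton]
      intro h
      exact one_ne_zero (congrFun h v)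
    rw [LinearMap.range_eq_top.2 G.boundary_surjective, finrank_top] at h1
    have := G.euler
    simp only [Module.finrank_fintype_fun_eq_card] at h1 h2
    omega

end Planarity
end PlaneGraph
namespace PlaneGraph

/-! ### Edge bounds as for simple planar graphs -/

section EdgeBounds

variable {V E F : Type*} [Fintype V] [Fintype E] [Fintype F]

open scoped Classical in
-- Contract the edges outside `J`, and let `Q` be the set of vertex classes. The chains on `J` that
-- satisfy the |R| conditions are coboundaries of functions on `Q`, so |J| - |R| ≤ |Q| - 1. If there
-- are at least two classes, the cut around each has at least three edges in `I`, and an edge has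
-- only two ends, so 3|Q| ≤ 2|I|.
lemma card_le_of_cycles_large (G : PlaneGraph V E F) {J I : Finset E} (R : Finset F)
    (hR : ∀ z : E → ℚ, (∀ e ∉ J, z e = 0) → (∀ f ∈ R, G.boundary z f = 0) → G.boundary z = 0)
    (hcut : ∀ z : E → ℚ, (∀ e ∉ J, z e = 0) → G.boundary z = 0 → z ≠ 0 →
      3 ≤ (I.filter (fun e => z e ≠ 0)).card) :
    J.card ≤ R.card ∨ 3 * (J.card + 1) ≤ 2 * I.card + 3 * R.card := by
  let s : Setoid V := Relation.EqvGen.setoid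
    (fun u v => ∃ e ∉ J, u = G.src (e, true) ∧ v = G.src (e, false))
  let Q := Quotient s
  have hs : ∀ e ∉ J, (⟦G.src (e, false)⟧ : Q) = ⟦G.src (e, true)⟧ := fun e he =>
    (Quotient.sound (Relation.EqvGen.rel _ _ ⟨e, he, rfl, rfl⟩)).symm
  have hconst : ∀ x : V → ℚ, (∀ e ∉ J, G.coboundary x e = 0) → ∀ u v, s u v → x u = x v := by
    intro x hx u v huv
    induction huv with
    | rel u v h =>
      obtain ⟨e, he, rfl, rfl⟩ := h
      have := hx e he
      rw [coboundary_apply] at this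
      linarith
    | refl => rfl
    | symm _ _ _ ih => exact ih.symm
    | trans _ _ _ _ _ ih1 ih2 => exact ih1.trans ih2
  let Φ : (Q → ℚ) →ₗ[ℚ] (E → ℚ) :=
    G.coboundary ∘ₗ LinearMap.funLeft ℚ ℚ (Quotient.mk s)
  have hΦ : ∀ w e, Φ w e = w ⟦G.src (e, false)⟧ - w ⟦G.src (e, true)⟧ := fun _ _ => rfl
  let ex : (J → ℚ) →ₗ[ℚ] (E → ℚ) :=
    { toFun := fun z e => if h : e ∈ J then z ⟨e, h⟩ else 0
      map_add' := fun x y => by ext e; by_cases h : e ∈ J <;> simp [h]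
      map_smul' := fun c x => by ext e; by_cases h : e ∈ J <;> simp [h] }
  have hex : Function.Injective ex := by
    intro x y h
    ext ⟨e, he⟩
    simpa [ex, he] using congrFun h e
  let g : (J → ℚ) →ₗ[ℚ] (R → ℚ) :=
    LinearMap.funLeft ℚ ℚ Subtype.val ∘ₗ G.boundary ∘ₗ ex
  have hle : (LinearMap.ker g).map ex ≤ LinearMap.range Φ := by
    rintro _ ⟨z, hz, rfl⟩
    have h0 : ∀ e ∉ J, ex z e = 0 := fun e he => by simp [ex, he]
    have hb : G.boundary (ex z) = 0 := hR _ h0 fun f hf => congrFun hz ⟨f, hf⟩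
    have : ex z ∈ LinearMap.ker G.boundary := hb
    rw [ker_boundary] at this
    obtain ⟨x, hx⟩ := this
    have hx' := hconst x (fun e he => by rw [hx, h0 e he])
    refine ⟨fun q => Quotient.lift x hx' q, ?_⟩
    rw [← hx]; rfl
  have h1 := Submodule.finrank_mono hle
  rw [← (Submodule.equivMapOfInjective ex hex _).finrank_eq] at h1
  have h2 := LinearMap.finrank_range_add_finrank_ker g
  have h3 := LinearMap.finrank_range_add_finrank_ker Φ
  have h4 : 1 ≤ Module.finrank ℚ (LinearMap.ker Φ) := by
    rw [Nat.one_le_iff_ne_zero, Ne, Submodule.finrank_eq_zero]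
    intro h
    have : (fun _ => 1 : Q → ℚ) ∈ LinearMap.ker Φ := by ext e; simp [hΦ]
    rw [h, Submodule.mem_bot] at this
    obtain ⟨v⟩ := G.nonempty
    exact one_ne_zero (congrFun this ⟦v⟧)
  have h5 := Submodule.finrank_le (LinearMap.range g)
  simp only [Module.finrank_fintype_fun_eq_card, Fintype.card_coe] at h2 h3 h5
  by_cases hQ : Fintype.card Q ≤ 1
  · left; omega
  right
  have h6 : 3 * Fintype.card Q ≤ 2 * I.card := by
    have hq : ∀ q : Q, 3 ≤ (I.filter (fun e => Φ (Pi.single q 1) e ≠ 0)).card := by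
      intro q
      refine hcut _ (fun e he => ?_) (G.boundary_coboundary _) ?_
      · rw [hΦ, hs e he, sub_self]
      · intro h
        obtain ⟨q', hq'⟩ := Fintype.exists_ne_of_one_lt_card (not_le.1 hQ) q
        obtain ⟨u, rfl⟩ := Quotient.exists_rep q
        obtain ⟨v, rfl⟩ := Quotient.exists_rep q'
        have := G.eq_of_coboundary_eq_zero h u v
        simp [LinearMap.funLeft_apply, hq'] at this
    calc 3 * Fintype.card Q = ∑ q : Q, 3 := by simp [mul_comm]
      _ ≤ ∑ q : Q, (I.filter (fun e => Φ (Pi.single q 1) e ≠ 0)).card :=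
        Finset.sum_le_sum fun q _ => hq q
      _ = ∑ e ∈ I, (Finset.univ.filter (fun q : Q => Φ (Pi.single q 1) e ≠ 0)).card := by
        simp only [Finset.card_filter]; rw [Finset.sum_comm]
      _ ≤ ∑ e ∈ I, 2 := by
        refine Finset.sum_le_sum fun e _ => ?_
        refine (Finset.card_le_card (t := {⟦G.src (e, false)⟧, ⟦G.src (e, true)⟧}) ?_).trans
          Finset.card_le_two
        intro q hq
        by_contra hn
        simp only [Finset.mem_insert, Finset.mem_singleton, not_or] at hn
        refine (Finset.mem_filter.1 hq).2 ?_
        rw [hΦ, Pi.single_eq_of_ne' hn.1, Pi.single_eq_of_ne' hn.2, sub_self]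
      _ = 2 * I.card := by simp [mul_comm]
  omega

lemma bd_ne_zero_iff (G : PlaneGraph V E F) (f : F) (e : E) :
    G.bd f e ≠ 0 ↔ (G.side (e, true) = some f ∧ G.side (e, false) ≠ some f) ∨
      (G.side (e, false) = some f ∧ G.side (e, true) ≠ some f) := by
  unfold bd
  by_cases h1 : G.side (e, true) = some f <;> by_cases h2 : G.side (e, false) = some f <;>
    simp [h1, h2]

/-- An edge is on the boundary of at most two faces. -/
lemma eq_or_eq_of_bd_ne_zero (G : PlaneGraph V E F) {f f' f'' : F} {e : E} (h : f ≠ f')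
    (h1 : G.bd f e ≠ 0) (h2 : G.bd f' e ≠ 0) (h3 : G.bd f'' e ≠ 0) : f'' = f ∨ f'' = f' := by
  rw [bd_ne_zero_iff] at h1 h2 h3
  grind

lemma bd_add_bd_eq_zero (G : PlaneGraph V E F) {f f' : F} {e : E} (h : f ≠ f')
    (h1 : G.bd f e ≠ 0) (h2 : G.bd f' e ≠ 0) : G.bd f e + G.bd f' e = 0 := by
  rw [bd_ne_zero_iff] at h1 h2
  unfold bd
  rcases h1 with ⟨a, b⟩ | ⟨a, b⟩ <;> rcases h2 with ⟨c, d⟩ | ⟨c, d⟩ <;> simp_all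

/-- Cycles of the dual graph that avoid the repetition of an edge have length at least three. -/
lemma three_le_card_of_private {G : PlaneGraph V E F} (hG : G.ShareAtMostOneEdge)
    {X : Finset F} {I : Finset E} (htouch : ∀ e ∈ I, ∃ f ∈ X, G.bd f e ≠ 0)
    (hpriv : ∀ f ∈ X, ∀ e ∈ I, ∀ e' ∈ I, G.bd f e ≠ 0 → G.bd f e' ≠ 0 →
      (∀ g ∈ X, g ≠ f → G.bd g e = 0) → (∀ g ∈ X, g ≠ f → G.bd g e' = 0) → e = e')
    {z : E → ℚ} (hz : ∀ f ∈ X, ∑ e ∈ I, (G.bd f e : ℚ) * z e = 0)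
    (hne : ∃ e ∈ I, z e ≠ 0) : 3 ≤ (I.filter (fun e => z e ≠ 0)).card := by
  classical
  obtain ⟨e, he, hze⟩ := hne
  -- The equation at `f` cannot have exactly one nonzero term.
  have hother : ∀ f ∈ X, ∀ e ∈ I, z e ≠ 0 → G.bd f e ≠ 0 →
      ∃ e' ∈ I, e' ≠ e ∧ z e' ≠ 0 ∧ G.bd f e' ≠ 0 := by
    intro f hf e he hze hb
    by_contra! h
    have := hz f hf
    rw [Finset.sum_eq_single e] at this
    · exact mul_ne_zero (Int.cast_ne_zero.2 hb) hze this
    · intro e' he' hee'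
      by_cases h0 : z e' = 0
      · simp [h0]
      · simp [h e' he' hee' h0]
    · exact fun h => absurd he h
  obtain ⟨f, hf, hfe⟩ := htouch e he
  obtain ⟨e', he', hee', hze', hfe'⟩ := hother f hf e he hze hfe
  by_contra hlt
  have hpair : ∀ e'' ∈ I, z e'' ≠ 0 → e'' = e ∨ e'' = e' := by
    intro e'' h1 h2
    by_contra! h3
    apply hlt
    have : ({e, e', e''} : Finset E) ⊆ I.filter (fun e => z e ≠ 0) := by
      intro x hx
      simp only [Finset.mem_insert, Finset.mem_singleton] at hx
      rcases hx with rfl | rfl | rfl <;> simp_all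
    refine le_trans (le_of_eq ?_) (Finset.card_le_card this)
    rw [Finset.card_eq_three.2 ⟨e, e', e'', hee'.symm, h3.1.symm, h3.2.symm, rfl⟩]
  have hsame : ∀ g ∈ X, G.bd g e ≠ 0 ↔ G.bd g e' ≠ 0 := by
    intro g hg
    constructor
    · intro h
      obtain ⟨x, hx, hxe, hzx, hgx⟩ := hother g hg e he hze h
      rcases hpair x hx hzx with rfl | rfl
      · exact absurd rfl hxe
      · exact hgx
    · intro h
      obtain ⟨x, hx, hxe, hzx, hgx⟩ := hother g hg e' he' hze' h
      rcases hpair x hx hzx with rfl | rfl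
      · exact hgx
      · exact absurd rfl hxe
  -- If the support is just `e` and `e'`, either a second face shares both with `f`, or both are
  -- private to `f`.
  by_cases hex : ∃ g ∈ X, g ≠ f ∧ G.bd g e ≠ 0
  · obtain ⟨g, hg, hgf, hge⟩ := hex
    exact hee' (hG g f hgf e e' hge hfe ((hsame g hg).1 hge) hfe').symm
  · push Not at hex
    refine hee' (hpriv f hf e he e' he' hfe hfe' hex fun g hg hgf => ?_).symm
    by_contra h
    exact (hsame g hg).2 h (hex g hg hgf)

open scoped Classical in
/-- The number of edges shared by two faces of a nonempty set is bounded as in a simple planar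
graph. -/
lemma card_shared_add_three_le {G : PlaneGraph V E F} (hG : G.ShareAtMostOneEdge) {B : Finset F}
    (hB : B.Nonempty) :
    (Finset.univ.filter (fun e => ∃ f ∈ B, ∃ f' ∈ B, f ≠ f' ∧ G.bd f e ≠ 0 ∧ G.bd f' e ≠ 0)).card
      + 3 ≤ 3 * B.card := by
  set I := Finset.univ.filter
    (fun e => ∃ f ∈ B, ∃ f' ∈ B, f ≠ f' ∧ G.bd f e ≠ 0 ∧ G.bd f' e ≠ 0) with hI
  obtain ⟨b, hb⟩ := hB
  have hmem : ∀ e, e ∈ I ↔ ∃ f ∈ B, ∃ f' ∈ B, f ≠ f' ∧ G.bd f e ≠ 0 ∧ G.bd f' e ≠ 0 := by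
    simp [hI]
  have hout : ∀ e ∈ I, ∀ f ∉ B, G.bd f e = 0 := by
    intro e he f hf
    obtain ⟨g, hg, g', hg', hne, h1, h2⟩ := (hmem e).1 he
    by_contra h
    rcases G.eq_or_eq_of_bd_ne_zero hne h1 h2 h with rfl | rfl <;> exact hf ‹_›
  have hsum : ∀ e ∈ I, ∑ f ∈ B, (G.bd f e : ℚ) = 0 := by
    intro e he
    obtain ⟨g, hg, g', hg', hne, h1, h2⟩ := (hmem e).1 he
    rw [← Finset.sum_subset (s₁ := {g, g'}), Finset.sum_pair hne]
    · exact_mod_cast G.bd_add_bd_eq_zero hne h1 h2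
    · intro x hx
      simp only [Finset.mem_insert, Finset.mem_singleton] at hx
      rcases hx with rfl | rfl <;> assumption
    · intro x _ hx
      simp only [Finset.mem_insert, Finset.mem_singleton] at hx
      by_contra h
      exact hx (G.eq_or_eq_of_bd_ne_zero hne h1 h2 (by exact_mod_cast h))
  have hbdI : ∀ z : E → ℚ, (∀ e ∉ I, z e = 0) → ∀ f,
      G.boundary z f = ∑ e ∈ I, (G.bd f e : ℚ) * z e := by
    intro z hz f
    rw [boundary_apply]
    exact (Finset.sum_subset (Finset.subset_univ _) fun e _ he => by simp [hz e he]).symm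
  have key := G.card_le_of_cycles_large (J := I) (I := I) (B.erase b) ?_ ?_
  · rw [Finset.card_erase_of_mem hb] at key
    have : 0 < B.card := Finset.card_pos.2 ⟨b, hb⟩
    omega
  · intro z hz h0
    have htot : ∑ f ∈ B, G.boundary z f = 0 := by
      simp only [hbdI z hz]
      rw [Finset.sum_comm]
      exact Finset.sum_eq_zero fun e he => by rw [← Finset.sum_mul, hsum e he, zero_mul]
    ext f
    by_cases hf : f ∈ B
    · by_cases hfb : f = b
      · rw [← Finset.sum_erase_add _ _ hb, Finset.sum_eq_zero h0, zero_add] at htot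
        rw [hfb, htot]; rfl
      · exact h0 f (Finset.mem_erase.2 ⟨hfb, hf⟩)
    · rw [hbdI z hz]
      exact Finset.sum_eq_zero fun e he => by simp [hout e he f hf]
  · intro z hz h0 hne
    refine three_le_card_of_private hG (X := B) ?_ ?_ (fun f _ => ?_) ?_
    · intro e he
      obtain ⟨g, hg, -, -, -, h1, -⟩ := (hmem e).1 he
      exact ⟨g, hg, h1⟩
    · intro f hf e he e' _ hfe _ hp _
      obtain ⟨g, hg, g', hg', hne, h1, h2⟩ := (hmem e).1 he
      by_cases hgf : g = f
      · exact absurd (hp g' hg' fun h => hne (hgf.trans h.symm)) h2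
      · exact absurd (hp g hg hgf) h1
    · rw [← hbdI z hz, h0]; rfl
    · by_contra! h
      exact hne (funext fun e => by
        by_cases he : e ∈ I
        · exact h e he
        · exact hz e he)

open scoped Classical in
/-- The edges on the boundary of no face outside `Φ`. -/
noncomputable def edgesOf (G : PlaneGraph V E F) (Φ : Finset F) : Finset E :=
  Finset.univ.filter (fun e => ∀ f, f ∉ Φ → G.bd f e = 0)

open scoped Classical in
/-- The edges on the boundary of a face in `X`, but of no face outside `Φ`. -/
noncomputable def edgesAt (G : PlaneGraph V E F) (Φ X : Finset F) : Finset E :=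
  (G.edgesOf Φ).filter (fun e => ∃ f ∈ X, G.bd f e ≠ 0)

/-- A nonempty set of faces that shares no edge with its complement in `Φ` and the unbounded
face. -/
def IsClosedIn (G : PlaneGraph V E F) (Φ C : Finset F) : Prop :=
  C ⊆ Φ ∧ C.Nonempty ∧ ∀ e ∈ G.edgesOf Φ, ∑ f ∈ C, G.bd f e = 0

lemma mem_edgesOf {G : PlaneGraph V E F} {Φ : Finset F} {e : E} :
    e ∈ G.edgesOf Φ ↔ ∀ f, f ∉ Φ → G.bd f e = 0 := by simp [edgesOf]

lemma mem_edgesAt {G : PlaneGraph V E F} {Φ X : Finset F} {e : E} :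
    e ∈ G.edgesAt Φ X ↔ (∀ f, f ∉ Φ → G.bd f e = 0) ∧ ∃ f ∈ X, G.bd f e ≠ 0 := by
  simp [edgesAt, mem_edgesOf]

open scoped Classical in
/-- If no set of faces is closed, then the columns of the boundary matrix span everything. -/
lemma span_columns_eq_top {G : PlaneGraph V E F} {Φ : Finset F}
    (h : ∀ C, ¬ G.IsClosedIn Φ C) :
    Submodule.span ℚ (Set.range (fun (e : G.edgesOf Φ) (f : Φ) => (G.bd f e : ℚ))) = ⊤ := by
  by_contra hne
  obtain ⟨φ, hφ, hle⟩ := Submodule.exists_le_ker_of_lt_top _ (lt_top_iff_ne_top.2 hne)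
  let y : F → ℚ := fun f => if hf : f ∈ Φ then φ (Pi.single ⟨f, hf⟩ 1) else 0
  have hy : ∀ e ∈ G.edgesOf Φ, ∑ f, y f * (G.bd f e : ℚ) = 0 := by
    intro e he
    have h1 : φ (fun f : Φ => (G.bd f e : ℚ)) = 0 :=
      hle (Submodule.subset_span ⟨⟨e, he⟩, rfl⟩)
    rw [LinearMap.pi_apply_eq_sum_univ φ] at h1
    rw [← Finset.sum_subset (Finset.subset_univ Φ), ← Finset.sum_coe_sort, ← h1]
    · refine Finset.sum_congr rfl fun f _ => ?_
      rw [smul_eq_mul, mul_comm]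
      congr 1
      simp only [y, f.2, dite_true]
      congr 1
      ext g
      simp [Pi.single_apply, eq_comm]
    · intro f _ hf
      simp [y, hf]
  have hex : ∃ f ∈ Φ, y f ≠ 0 := by
    by_contra! h0
    apply hφ
    refine LinearMap.pi_ext' fun f => LinearMap.ext_ring ?_
    simpa [y] using h0 f f.2
  obtain ⟨f, hf, hyf⟩ := hex
  -- The relation `y` takes equal values on the two sides of each remaining edge, the unbounded face
  -- counting as 0. Hence a level set of a nonzero value is closed.
  refine h (Φ.filter (fun g => y g = y f))
    ⟨Finset.filter_subset _ _, ⟨f, by simp [hf]⟩, fun e he => ?_⟩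
  have h2 := hy e he
  have h4 : (∑ g, (if y g = y f then 1 else 0 : ℚ) * (G.bd g e : ℚ)) = 0 := by
    rw [sum_mul_bd] at h2 ⊢
    cases h5 : G.side (e, true) <;> cases h6 : G.side (e, false) <;> simp_all [sub_eq_zero]
    all_goals exact fun h => absurd h.symm hyf
  have h5 : ∑ g ∈ Φ.filter (fun g => y g = y f), (G.bd g e : ℚ) = 0 := by
    rw [← h4, Finset.sum_filter, ← Finset.sum_subset (Finset.subset_univ Φ)]
    · exact Finset.sum_congr rfl fun g _ => by split_ifs <;> simp
    · intro g _ hg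
      rw [mem_edgesOf.1 he g hg]; simp
  exact_mod_cast h5

/-- The indicator function of such a set would agree across every edge. -/
lemma not_isClosedIn_univ (G : PlaneGraph V E F) (C : Finset F) :
    ¬ G.IsClosedIn Finset.univ C := by
  classical
  rintro ⟨-, ⟨f, hf⟩, h⟩
  have := G.eq_zero_of_side_invariant (y := fun g => if g ∈ C then (1 : ℤ) else 0) fun e => by
    rw [← sub_eq_zero, ← sum_mul_bd]
    simpa using h e (by simp [mem_edgesOf])
  simpa [hf] using congrFun this f

open scoped Classical in
/-- Let every face in `X` have at most one edge in `I` that is on no other face in `X`. If the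
faces outside `X` are connected to the unbounded face, then the size of `I` is bounded as in a
simple planar graph. -/
lemma card_add_three_le {G : PlaneGraph V E F} (hG : G.ShareAtMostOneEdge) {Φ X : Finset F}
    (hX : X ⊆ Φ) (hX2 : 2 ≤ X.card) (hcl : ∀ C, ¬ G.IsClosedIn (Φ \ X) C) {I : Finset E}
    (hI : I ⊆ G.edgesAt Φ X)
    (hpriv : ∀ f ∈ X, ∀ e ∈ I, ∀ e' ∈ I, G.bd f e ≠ 0 → G.bd f e' ≠ 0 →
      (∀ g ∈ X, g ≠ f → G.bd g e = 0) → (∀ g ∈ X, g ≠ f → G.bd g e' = 0) → e = e') :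
    I.card + 3 ≤ 3 * X.card := by
  -- The chosen edges `τ` act as a spanning forest that joins the faces outside `X` to the unbounded
  -- face. They are |Φ \ X| in number and touch no face of `X`, so they offset the conditions at the
  -- faces outside `X`.
  obtain ⟨κ, a, ha, hspan, hli⟩ := exists_linearIndependent' ℚ
    (fun (e : G.edgesOf (Φ \ X)) (f : (Φ \ X : Finset F)) => (G.bd f e : ℚ))
  rw [span_columns_eq_top hcl] at hspan
  have : Fintype κ := Fintype.ofInjective a ha
  have hcard : Fintype.card κ = (Φ \ X).card := by
    have := finrank_span_eq_card hli
    rw [hspan, finrank_top, Module.finrank_fintype_fun_eq_card, Fintype.card_coe] at this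
    exact this.symm
  have hinj : Function.Injective (fun i => (a i : E)) := Subtype.val_injective.comp ha
  let τ : Finset E := Finset.univ.image (fun i => (a i : E))
  have hτcard : τ.card = (Φ \ X).card := by
    rw [Finset.card_image_of_injective _ hinj, Finset.card_univ, hcard]
  have hτ : ∀ e ∈ τ, ∀ f, f ∉ Φ \ X → G.bd f e = 0 := by
    intro e he
    obtain ⟨i, -, rfl⟩ := Finset.mem_image.1 he
    exact mem_edgesOf.1 (a i).2
  have hdisj : Disjoint I τ := by
    rw [Finset.disjoint_left]
    intro e he heτ
    obtain ⟨-, f, hf, hfe⟩ := mem_edgesAt.1 (hI he)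
    exact hfe (hτ e heτ f (by simp [hf]))
  have hbd : ∀ z : E → ℚ, (∀ e ∉ I ∪ τ, z e = 0) → ∀ f,
      G.boundary z f = ∑ e ∈ I, (G.bd f e : ℚ) * z e + ∑ e ∈ τ, (G.bd f e : ℚ) * z e := by
    intro z hz f
    rw [← Finset.sum_union hdisj, boundary_apply]
    exact (Finset.sum_subset (Finset.subset_univ _) fun e _ he => by simp [hz e he]).symm
  have key := G.card_le_of_cycles_large (J := I ∪ τ) (I := I) Φ ?_ ?_
  · rw [Finset.card_union_of_disjoint hdisj, hτcard, Finset.card_sdiff_of_subset hX] at key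
    have := Finset.card_le_card hX
    omega
  · intro z hz h0
    ext f
    by_cases hf : f ∈ Φ
    · exact h0 f hf
    · rw [hbd z hz, Finset.sum_eq_zero, Finset.sum_eq_zero, add_zero]; · rfl
      · intro e he
        rw [hτ e he f (by simp [hf])]; simp
      · intro e he
        rw [(mem_edgesAt.1 (hI he)).1 f hf]; simp
  · intro z hz h0 hne
    refine three_le_card_of_private hG (X := X) (fun e he => (mem_edgesAt.1 (hI he)).2) hpriv ?_ ?_
    · intro f hf
      have h1 := congrFun h0 f
      rw [hbd z hz, Finset.sum_eq_zero (s := τ), add_zero] at h1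
      · exact h1
      · intro e he
        rw [hτ e he f (by simp [hf])]; simp
    -- A chain on `τ` alone with zero boundary is zero, by independence of the columns.
    · by_contra! hzI
      apply hne
      have h2 : ∑ i, z (a i) • (fun (f : (Φ \ X : Finset F)) => (G.bd f (a i) : ℚ)) = 0 := by
        ext f
        have h1 := congrFun h0 f
        rw [hbd z hz, Finset.sum_eq_zero (s := I), zero_add, Finset.sum_image
          (fun i _ j _ h => hinj h)] at h1
        · simpa [Finset.sum_apply, mul_comm] using h1
        · intro e he; rw [hzI e he, mul_zero]
      have h3 := Fintype.linearIndependent_iff.1 hli _ h2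
      ext e
      by_cases heI : e ∈ I
      · exact hzI e heI
      · by_cases heτ : e ∈ τ
        · obtain ⟨i, -, rfl⟩ := Finset.mem_image.1 heτ
          exact h3 i
        · exact hz e (by simp [heI, heτ])

end EdgeBounds
end PlaneGraph
namespace PlaneGraph

/-! ### Combinatorics of contraction sequences -/

section Contraction

variable {V E F : Type*} [Fintype V] [Fintype E] [Fintype F]

lemma edgesAt_mono (G : PlaneGraph V E F) (Φ : Finset F) {X Y : Finset F} (h : X ⊆ Y) :
    G.edgesAt Φ X ⊆ G.edgesAt Φ Y := by
  intro e he
  rw [mem_edgesAt] at he ⊢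
  exact ⟨he.1, he.2.imp fun f hf => ⟨h hf.1, hf.2⟩⟩

open scoped Classical in
lemma mem_edgesOf_sdiff {G : PlaneGraph V E F} {Φ T : Finset F} {e : E} :
    e ∈ G.edgesOf (Φ \ T) ↔ e ∈ G.edgesOf Φ ∧ e ∉ G.edgesAt Φ T := by
  simp only [mem_edgesOf, mem_edgesAt, Finset.mem_sdiff, not_and, not_exists, not_not]
  constructor
  · intro h
    exact ⟨fun f hf => h f fun h1 => absurd h1 hf, fun _ f hf => h f fun _ => hf⟩
  · rintro ⟨h1, h2⟩ f hf
    by_cases hΦ : f ∈ Φ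
    · exact h2 h1 f (hf hΦ)
    · exact h1 f hΦ

open scoped Classical in
lemma mem_edgesAt_sdiff {G : PlaneGraph V E F} {Φ T X : Finset F} {e : E} :
    e ∈ G.edgesAt (Φ \ T) X ↔ e ∈ G.edgesAt Φ X ∧ e ∉ G.edgesAt Φ T := by
  rw [mem_edgesAt, ← mem_edgesOf, mem_edgesOf_sdiff, mem_edgesOf, mem_edgesAt (X := X)]
  tauto

/-- A set of faces that is minimal among the nonempty sets with at most three times as many edges
as faces. -/
def IsMinContractible (G : PlaneGraph V E F) (Φ X : Finset F) : Prop :=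
  X ⊆ Φ ∧ X.Nonempty ∧ (G.edgesAt Φ X).card ≤ 3 * X.card ∧
    ∀ T, T ⊂ X → T.Nonempty → 3 * T.card < (G.edgesAt Φ T).card

lemma exists_isMinContractible (G : PlaneGraph V E F) {Φ X : Finset F} (hX : X ⊆ Φ)
    (hne : X.Nonempty) (hc : (G.edgesAt Φ X).card ≤ 3 * X.card) :
    ∃ W ⊆ X, G.IsMinContractible Φ W := by
  induction X using Finset.strongInduction with
  | H X ih =>
    by_cases h : ∃ T, T ⊂ X ∧ T.Nonempty ∧ (G.edgesAt Φ T).card ≤ 3 * T.card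
    · obtain ⟨T, hT, hTne, hTc⟩ := h
      obtain ⟨W, hW, hWm⟩ := ih T hT (hT.subset.trans hX) hTne hTc
      exact ⟨W, hW.trans hT.subset, hWm⟩
    · push Not at h
      exact ⟨X, subset_rfl, hX, hne, hc, fun T hT hTne => h T hT hTne⟩

namespace IsClosedIn

variable {G : PlaneGraph V E F} {Φ C : Finset F}

lemma exists_ne (h : G.IsClosedIn Φ C) {e : E} (he : e ∈ G.edgesOf Φ) {f : F} (hf : f ∈ C)
    (hfe : G.bd f e ≠ 0) : ∃ f' ∈ C, f' ≠ f ∧ G.bd f' e ≠ 0 := by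
  by_contra! h0
  have := h.2.2 e he
  rw [Finset.sum_eq_single f h0 fun h => absurd hf h] at this
  exact hfe this

lemma mem_of_bd_ne_zero (h : G.IsClosedIn Φ C) {e : E} (he : e ∈ G.edgesOf Φ) {f g : F}
    (hf : f ∈ C) (hfe : G.bd f e ≠ 0) (hge : G.bd g e ≠ 0) : g ∈ C := by
  obtain ⟨f', hf', hne, hfe'⟩ := h.exists_ne he hf hfe
  rcases G.eq_or_eq_of_bd_ne_zero hne hfe' hfe hge with rfl | rfl <;> assumption

/-- Every remaining edge on a closed set is shared by two of its faces. -/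
lemma card_edgesAt (hG : G.ShareAtMostOneEdge) (h : G.IsClosedIn Φ C) :
    (G.edgesAt Φ C).card + 3 ≤ 3 * C.card := by
  classical
  refine le_trans (Nat.add_le_add_right (Finset.card_le_card ?_) 3)
    (card_shared_add_three_le hG h.2.1)
  intro e he
  obtain ⟨h1, f, hf, hfe⟩ := mem_edgesAt.1 he
  obtain ⟨f', hf', hne, hfe'⟩ := h.exists_ne (mem_edgesOf.2 h1) hf hfe
  exact Finset.mem_filter.2 ⟨Finset.mem_univ _, f, hf, f', hf', hne.symm, hfe, hfe'⟩

open scoped Classical in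
-- The slack of three in `card_edgesAt` pays for the removed face; this produces contractible sets
-- that omit a prescribed face.
lemma card_edgesAt_erase (hG : G.ShareAtMostOneEdge) (h : G.IsClosedIn Φ C) {f : F} (hf : f ∈ C) :
    (G.edgesAt Φ (C.erase f)).card ≤ 3 * (C.erase f).card := by
  have h1 := h.card_edgesAt hG
  have h2 := Finset.card_le_card (G.edgesAt_mono Φ (Finset.erase_subset f C))
  rw [Finset.card_erase_of_mem hf]
  omega

open scoped Classical in
-- A smallest closed set around `t` is minimal among all closed sets: a closed proper subset without
-- `t` could be subtracted.
lemma exists_minimal (h : G.IsClosedIn Φ C) {t : F} (ht : t ∈ C) :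
    ∃ D ⊆ C, t ∈ D ∧ G.IsClosedIn Φ D ∧ ∀ D', D' ⊂ D → ¬ G.IsClosedIn Φ D' := by
  obtain ⟨D, hD, hmin⟩ := Finset.exists_min_image
    (C.powerset.filter (fun D => t ∈ D ∧ G.IsClosedIn Φ D)) Finset.card
    ⟨C, by simp [ht, h]⟩
  simp only [Finset.mem_filter, Finset.mem_powerset] at hD hmin
  refine ⟨D, hD.1, hD.2.1, hD.2.2, fun D' hD' hcl => ?_⟩
  by_cases htD : t ∈ D'
  · exact absurd (hmin D' ⟨hD'.subset.trans hD.1, htD, hcl⟩)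
      (not_le.2 (Finset.card_lt_card hD'))
  · have h1 : G.IsClosedIn Φ (D \ D') := by
      refine ⟨Finset.sdiff_subset.trans hD.2.2.1, ⟨t, by simp [hD.2.1, htD]⟩, fun e he => ?_⟩
      have := Finset.sum_sdiff (f := fun f => G.bd f e) hD'.subset
      rw [hD.2.2.2.2 e he, hcl.2.2 e he] at this
      simpa using this
    refine absurd (hmin _ ⟨Finset.sdiff_subset.trans hD.1, by simp [hD.2.1, htD], h1⟩)
      (not_le.2 (Finset.card_lt_card ?_))
    exact Finset.sdiff_ssubset hD'.subset hcl.2.1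

open scoped Classical in
-- No remaining edge joins `C` to its complement. If `C` cut `T`, the two parts would have disjoint
-- edge sets, each with more than three edges per face by minimality, too many for `T`.
lemma disjoint_or_subset (h : G.IsClosedIn Φ C) {T : Finset F} (hT : G.IsMinContractible Φ T) :
    Disjoint T C ∨ T ⊆ C := by
  by_contra! hn
  rw [Finset.not_disjoint_iff] at hn
  obtain ⟨⟨t, htT, htC⟩, hsub⟩ := hn
  obtain ⟨u, huT, huC⟩ := Finset.not_subset.1 hsub
  have h1 := hT.2.2.2 (T ∩ C) ⟨Finset.inter_subset_left, fun h =>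
    huC (Finset.mem_inter.1 (h huT)).2⟩ ⟨t, by simp [htT, htC]⟩
  have h2 := hT.2.2.2 (T \ C) ⟨Finset.sdiff_subset, fun h =>
    (Finset.mem_sdiff.1 (h htT)).2 htC⟩ ⟨u, by simp [huT, huC]⟩
  have h3 : Disjoint (G.edgesAt Φ (T ∩ C)) (G.edgesAt Φ (T \ C)) := by
    rw [Finset.disjoint_left]
    intro e he he'
    obtain ⟨h4, f, hf, hfe⟩ := mem_edgesAt.1 he
    obtain ⟨-, g, hg, hge⟩ := mem_edgesAt.1 he'
    exact (Finset.mem_sdiff.1 hg).2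
      (h.mem_of_bd_ne_zero (mem_edgesOf.2 h4) (Finset.mem_inter.1 hf).2 hfe hge)
  have h4 := Finset.card_le_card (Finset.union_subset
    (G.edgesAt_mono Φ (Finset.inter_subset_left (s₁ := T) (s₂ := C)))
    (G.edgesAt_mono Φ (Finset.sdiff_subset (s := T) (t := C))))
  rw [Finset.card_union_of_disjoint h3] at h4
  have h5 := Finset.card_inter_add_card_sdiff T C
  have := hT.2.2.1
  omega

end IsClosedIn

open scoped Classical in
/-- `Φ i` is the set of faces left after the contractions along `S 0, …, S (i - 1)`, and the
hypotheses of the theorem hold. -/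
structure IsContractionSeq (G : PlaneGraph V E F) (k : ℕ) (S Φ : ℕ → Finset F) : Prop where
  zero : Φ 0 = Finset.univ
  succ : ∀ i < k, Φ (i + 1) = Φ i \ S i
  isMin : ∀ i < k, G.IsMinContractible (Φ i) (S i)
  disj : ∀ i ≤ k, ∀ T T', G.IsMinContractible (Φ i) T → G.IsMinContractible (Φ i) T' → T ≠ T' →
    Disjoint (G.edgesAt (Φ i) T) (G.edgesAt (Φ i) T')
  last : ∀ T, T ⊂ Φ k → T.Nonempty → 3 * T.card < (G.edgesAt (Φ k) T).card

namespace IsContractionSeq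

variable {G : PlaneGraph V E F} {k : ℕ} {S Φ : ℕ → Finset F}

lemma not_share (h : G.IsContractionSeq k S Φ) {i : ℕ} (hi : i ≤ k) {T T' : Finset F}
    (hT : G.IsMinContractible (Φ i) T) (hT' : G.IsMinContractible (Φ i) T') {e : E}
    (he : e ∈ G.edgesAt (Φ i) T) (he' : e ∈ G.edgesAt (Φ i) T') : T = T' := by
  by_contra hne
  exact Finset.disjoint_left.1 (h.disj i hi T T' hT hT' hne) he he'

/-- Induction backwards from the last graph, where a closed set of two or more faces would have a
contractible proper subset. At an earlier stage, either `S i` misses `C` and nothing changes, or `S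
i ⊆ C`. Then omitting a face of `S i` yields another minimal contractible set `T` in `C`. A face `t`
of `T` keeps an edge after `S i` is contracted, yet by induction `{t}` is closed. -/
lemma card_le_one_of_minimal_closed (h : G.IsContractionSeq k S Φ) (hG : G.ShareAtMostOneEdge)
    (n : ℕ) : ∀ i, i + n = k → ∀ C, G.IsClosedIn (Φ i) C →
      (∀ D, D ⊂ C → ¬ G.IsClosedIn (Φ i) D) → C.card ≤ 1 := by
  classical
  induction n with
  | zero =>
    rintro i rfl C hC -
    by_contra! h2
    obtain ⟨f, hf⟩ := hC.2.1
    have h1 := h.last (C.erase f) ((Finset.erase_ssubset hf).trans_subset hC.1)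
      (Finset.card_pos.1 (by rw [Finset.card_erase_of_mem hf]; omega))
    exact absurd (hC.card_edgesAt_erase hG hf) (not_le.2 h1)
  | succ n ih =>
    intro i hi C hC hmin
    by_contra! h2
    have hik : i < k := by omega
    have hsucc := h.succ i hik
    have hSi := h.isMin i hik
    rcases hC.disjoint_or_subset hSi with hd | hsub
    · refine absurd (ih (i + 1) (by omega) C ?_ ?_) (not_le.2 h2)
      · refine ⟨?_, hC.2.1, fun e he => hC.2.2 e ?_⟩
        · rw [hsucc]
          exact Finset.subset_sdiff.2 ⟨hC.1, hd.symm⟩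
        · rw [hsucc, mem_edgesOf_sdiff] at he
          exact he.1
      · intro D hD hcl
        refine hmin D hD ⟨hD.subset.trans hC.1, hcl.2.1, fun e he => ?_⟩
        by_cases heT : e ∈ G.edgesAt (Φ i) (S i)
        · obtain ⟨-, t, ht, hte⟩ := mem_edgesAt.1 heT
          refine Finset.sum_eq_zero fun d hd' => ?_
          by_contra hde
          exact Finset.disjoint_left.1 hd ht (hC.mem_of_bd_ne_zero he (hD.subset hd') hde hte)
        · exact hcl.2.2 e (by rw [hsucc, mem_edgesOf_sdiff]; exact ⟨he, heT⟩)
    · obtain ⟨f, hf⟩ := hSi.2.1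
      obtain ⟨T, hT, hTm⟩ := G.exists_isMinContractible
        ((Finset.erase_subset f C).trans hC.1)
        (Finset.card_pos.1 (by rw [Finset.card_erase_of_mem (hsub hf)]; omega))
        (hC.card_edgesAt_erase hG (hsub hf))
      have hne : T ≠ S i := fun h0 => Finset.notMem_erase f C (hT (h0 ▸ hf))
      obtain ⟨t, ht⟩ := hTm.2.1
      have htC : t ∈ C := (Finset.mem_erase.1 (hT ht)).2
      have hts : ¬ G.IsClosedIn (Φ i) {t} := by
        refine hmin _ ⟨Finset.singleton_subset_iff.2 htC, fun h0 => ?_⟩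
        have := Finset.card_le_card h0
        rw [Finset.card_singleton] at this
        omega
      obtain ⟨e, he, hte⟩ : ∃ e ∈ G.edgesOf (Φ i), G.bd t e ≠ 0 := by
        by_contra! h0
        exact hts ⟨Finset.singleton_subset_iff.2 (hC.1 htC), Finset.singleton_nonempty t,
          fun e he => by simpa using h0 e he⟩
      have heT : e ∈ G.edgesAt (Φ i) T := mem_edgesAt.2 ⟨mem_edgesOf.1 he, t, ht, hte⟩
      have heS : e ∉ G.edgesAt (Φ i) (S i) := fun h0 =>
        hne (h.not_share hik.le hTm hSi heT h0)
      have htS : t ∉ S i := fun h0 => heS (mem_edgesAt.2 ⟨mem_edgesOf.1 he, t, h0, hte⟩)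
      have hcl : G.IsClosedIn (Φ (i + 1)) (C \ S i) := by
        rw [hsucc]
        refine ⟨Finset.sdiff_subset_sdiff hC.1 subset_rfl, ⟨t, by simp [htC, htS]⟩,
          fun e he => ?_⟩
        rw [mem_edgesOf_sdiff] at he
        rw [← hC.2.2 e he.1]
        refine Finset.sum_subset Finset.sdiff_subset fun g hg hg' => ?_
        by_contra hge
        exact he.2 (mem_edgesAt.2 ⟨mem_edgesOf.1 he.1, g, by simpa [hg] using hg', hge⟩)
      obtain ⟨D, -, htD, hDcl, hDmin⟩ := hcl.exists_minimal (t := t) (by simp [htC, htS])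
      have hD1 := ih (i + 1) (by omega) D hDcl hDmin
      have hDt : D = {t} := (Finset.eq_of_subset_of_card_le
        (Finset.singleton_subset_iff.2 htD) (by simpa using hD1)).symm
      have := hDcl.2.2 e (by rw [hsucc, mem_edgesOf_sdiff]; exact ⟨he, heS⟩)
      rw [hDt, Finset.sum_singleton] at this
      exact hte this

/-- Every set of remaining faces shares an edge with the other remaining faces or with the
unbounded face. -/
lemma not_isClosedIn (h : G.IsContractionSeq k S Φ) (hG : G.ShareAtMostOneEdge) :
    ∀ i ≤ k, ∀ C, ¬ G.IsClosedIn (Φ i) C := by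
  classical
  intro i
  induction i with
  | zero =>
    intro _ C
    rw [h.zero]
    exact G.not_isClosedIn_univ C
  | succ i ih =>
    intro hik C hC
    have hsucc := h.succ i hik
    have hSi := h.isMin i hik
    obtain ⟨t, ht⟩ := hC.2.1
    obtain ⟨D, -, htD, hDcl, hDmin⟩ := hC.exists_minimal ht
    have hD1 := h.card_le_one_of_minimal_closed hG (k - (i + 1)) (i + 1) (by omega) D hDcl hDmin
    have hDt : D = {t} := (Finset.eq_of_subset_of_card_le
      (Finset.singleton_subset_iff.2 htD) (by simpa using hD1)).symm
    subst hDt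
    have htΦ : t ∈ Φ i \ S i := hsucc ▸ hDcl.1 htD
    have htS : t ∉ S i := (Finset.mem_sdiff.1 htΦ).2
    -- If `{t}` has become closed, the contraction of `S i` took all its edges.
    have hsub : ∀ e ∈ G.edgesOf (Φ i), G.bd t e ≠ 0 → e ∈ G.edgesAt (Φ i) (S i) := by
      intro e he hte
      by_contra heS
      have := hDcl.2.2 e (by rw [hsucc, mem_edgesOf_sdiff]; exact ⟨he, heS⟩)
      rw [Finset.sum_singleton] at this
      exact hte this
    obtain ⟨e, he, hte⟩ : ∃ e ∈ G.edgesOf (Φ i), G.bd t e ≠ 0 := by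
      by_contra! h0
      exact ih (by omega) {t} ⟨Finset.singleton_subset_iff.2 (Finset.mem_sdiff.1 htΦ).1,
        Finset.singleton_nonempty t, fun e he => by simpa using h0 e he⟩
    obtain ⟨f, hf⟩ := hSi.2.1
    have hcard : (insert t ((S i).erase f)).card = (S i).card := by
      rw [Finset.card_insert_of_notMem fun h0 => htS (Finset.mem_erase.1 h0).2,
        Finset.card_erase_of_mem hf]
      have := Finset.card_pos.2 ⟨f, hf⟩
      omega
    -- Exchanging `f` for `t` keeps the number of faces and adds no edge. A minimal contractible set
    -- in the result omits `f`, so it must contain `t` and shares the edge `e` with `S i`.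
    have hex : ∃ W ⊆ insert t ((S i).erase f), G.IsMinContractible (Φ i) W := by
      refine G.exists_isMinContractible ?_ (Finset.insert_nonempty _ _) ?_
      · exact Finset.insert_subset (Finset.mem_sdiff.1 htΦ).1
          ((Finset.erase_subset _ _).trans hSi.1)
      · rw [hcard]
        refine le_trans (Finset.card_le_card fun x hx => ?_) hSi.2.2.1
        obtain ⟨h1, g, hg, hgx⟩ := mem_edgesAt.1 hx
        rcases Finset.mem_insert.1 hg with rfl | h2
        · exact hsub x (mem_edgesOf.2 h1) hgx
        · exact mem_edgesAt.2 ⟨h1, g, (Finset.mem_erase.1 h2).2, hgx⟩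
    obtain ⟨W, hW, hWm⟩ := hex
    have hfW : f ∉ W := fun h0 => by
      rcases Finset.mem_insert.1 (hW h0) with rfl | h1
      · exact htS hf
      · exact Finset.notMem_erase f _ h1
    have htW : t ∈ W := by
      by_contra htW
      refine absurd hWm.2.2.1 (not_le.2 (hSi.2.2.2 W ⟨?_, fun h0 => hfW (h0 hf)⟩ hWm.2.1))
      intro x hx
      rcases Finset.mem_insert.1 (hW hx) with rfl | h1
      · exact absurd hx htW
      · exact (Finset.mem_erase.1 h1).2
    have := h.not_share (by omega) hWm hSi
      (mem_edgesAt.2 ⟨mem_edgesOf.1 he, t, htW, hte⟩) (hsub e he hte)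
    exact hfW (this ▸ hf)

open scoped Classical in
/-- Removing a face that has two edges to itself. -/
lemma card_edgesAt_erase_add_two_le {X Ψ : Finset F} {f : F} {e e' : E}
    (hee : e ≠ e') (he : e ∈ G.edgesAt Ψ X) (he' : e' ∈ G.edgesAt Ψ X)
    (hp : ∀ g ∈ X, g ≠ f → G.bd g e = 0) (hp' : ∀ g ∈ X, g ≠ f → G.bd g e' = 0) :
    (G.edgesAt Ψ (X.erase f)).card + 2 ≤ (G.edgesAt Ψ X).card := by
  have hsub : G.edgesAt Ψ (X.erase f) ⊆ G.edgesAt Ψ X \ {e, e'} := by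
    intro x hx
    have hxX := G.edgesAt_mono Ψ (Finset.erase_subset f X) hx
    obtain ⟨-, g, hg, hgx⟩ := mem_edgesAt.1 hx
    obtain ⟨hgf, hgX⟩ := Finset.mem_erase.1 hg
    rw [Finset.mem_sdiff]
    refine ⟨hxX, fun h0 => ?_⟩
    rcases Finset.mem_insert.1 h0 with rfl | h1
    · exact hgx (hp g hgX hgf)
    · rw [Finset.mem_singleton] at h1
      subst h1
      exact hgx (hp' g hgX hgf)
  have h1 := Finset.card_le_card hsub
  have h2 : ({e, e'} : Finset E) ⊆ G.edgesAt Ψ X := by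
    intro x hx
    rcases Finset.mem_insert.1 hx with rfl | h1
    · exact he
    · rw [Finset.mem_singleton] at h1; exact h1 ▸ he'
  have h3 := Finset.card_le_card h2
  rw [Finset.card_sdiff_of_subset h2, Finset.card_pair hee] at h1
  rw [Finset.card_pair hee] at h3
  omega

/-- A minimal contractible set has three times as many edges as faces, unless it is a single face
with one or two edges. -/
lemma card_eq_or_singleton (h : G.IsContractionSeq k S Φ) (hG : G.ShareAtMostOneEdge)
    {i : ℕ} (hi : i < k) :
    (G.edgesAt (Φ i) (S i)).card = 3 * (S i).card ∨
      (∃ f, S i = {f}) ∧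
        ((G.edgesAt (Φ i) (S i)).card = 1 ∨ (G.edgesAt (Φ i) (S i)).card = 2) := by
  classical
  have hSi := h.isMin i hi
  have hpos := Finset.card_pos.2 hSi.2.1
  by_cases h1 : (S i).card = 1
  · obtain ⟨f, hf⟩ := Finset.card_eq_one.1 h1
    have h0 : (G.edgesAt (Φ i) (S i)).card ≠ 0 := by
      intro h0
      rw [Finset.card_eq_zero] at h0
      refine h.not_isClosedIn hG i hi.le (S i) ⟨hSi.1, hSi.2.1, fun e he =>
        Finset.sum_eq_zero fun g hg => ?_⟩
      by_contra hge
      exact Finset.notMem_empty e (h0 ▸ mem_edgesAt.2 ⟨mem_edgesOf.1 he, g, hg, hge⟩)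
    have := hSi.2.2.1
    by_cases h3 : (G.edgesAt (Φ i) (S i)).card = 3 * (S i).card
    · exact Or.inl h3
    · exact Or.inr ⟨⟨f, hf⟩, by omega⟩
  · left
    by_contra hlt
    have hle := hSi.2.2.1
    -- With fewer than 3|S i| edges in all, removing a face loses at most one edge. So no face has
    -- two private edges, and the planar bound 3|S i| - 3 contradicts the 3|S i| - 2 edges present.
    have herase : ∀ f ∈ S i, 3 * (S i).card < (G.edgesAt (Φ i) ((S i).erase f)).card + 3 := by
      intro f hf
      have := hSi.2.2.2 ((S i).erase f) (Finset.erase_ssubset hf)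
        (Finset.card_pos.1 (by rw [Finset.card_erase_of_mem hf]; omega))
      rw [Finset.card_erase_of_mem hf] at this
      omega
    have h2 := card_add_three_le hG hSi.1 (by omega)
      (by rw [← h.succ i hi]; exact h.not_isClosedIn hG (i + 1) hi) (I := G.edgesAt (Φ i) (S i))
      subset_rfl ?_
    · obtain ⟨f, hf⟩ := hSi.2.1
      have h3 := herase f hf
      have h4 := Finset.card_le_card (G.edgesAt_mono (Φ i) (Finset.erase_subset f (S i)))
      omega
    · intro f hf e he e' he' hfe hfe' hp hp'
      by_contra hee
      have h5 := card_edgesAt_erase_add_two_le hee he he' hp hp'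
      have h6 := herase f hf
      omega

lemma subset_of_le (h : G.IsContractionSeq k S Φ) {i l : ℕ} (hil : i ≤ l) (hl : l ≤ k) :
    Φ l ⊆ Φ i := by
  classical
  induction l, hil using Nat.le_induction with
  | base => exact subset_rfl
  | succ l hil ih =>
    rw [h.succ l hl]
    exact Finset.sdiff_subset.trans (ih (by omega))

lemma edgesOf_mono (G : PlaneGraph V E F) {X Y : Finset F} (h : X ⊆ Y) :
    G.edgesOf X ⊆ G.edgesOf Y := by
  intro e he
  rw [mem_edgesOf] at he ⊢
  exact fun f hf => he f fun h0 => hf (h h0)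

/-- A face that is contracted while it has at most two edges has not lost any edge before. -/
lemma edgesAt_eq_of_card_le_two (h : G.IsContractionSeq k S Φ) (hG : G.ShareAtMostOneEdge)
    {l : ℕ} (hl : l < k) {f₀ : F} (hS : S l = {f₀})
    (hcard : (G.edgesAt (Φ l) {f₀}).card ≤ 2) {i : ℕ} (hil : i ≤ l) :
    G.edgesAt (Φ i) {f₀} = G.edgesAt (Φ l) {f₀} := by
  classical
  induction hil using Nat.decreasingInduction with
  | self => rfl
  | of_succ i hil ih =>
    rw [← ih]
    have hik : i < k := by omega
    have hsucc := h.succ i hik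
    have hSi := h.isMin i hik
    have hf₀l : f₀ ∈ Φ l := (h.isMin l hl).1 (by simp [hS])
    have hf₀' : f₀ ∈ Φ i \ S i := hsucc ▸ h.subset_of_le hil hl.le hf₀l
    obtain ⟨hf₀, hf₀S⟩ := Finset.mem_sdiff.1 hf₀'
    by_contra hne
    obtain ⟨e, heF, heS⟩ : ∃ e, e ∈ G.edgesAt (Φ i) {f₀} ∧ e ∈ G.edgesAt (Φ i) (S i) := by
      by_contra! h0
      apply hne
      ext x
      rw [hsucc, mem_edgesAt_sdiff]
      exact ⟨fun hx => ⟨hx, h0 x hx⟩, fun hx => hx.1⟩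
    have hbdF : ∀ x, x ∈ G.edgesAt (Φ i) {f₀} ↔ x ∈ G.edgesOf (Φ i) ∧ G.bd f₀ x ≠ 0 := by
      intro x; rw [mem_edgesAt, mem_edgesOf]; simp
    -- no other minimal contractible set contains `f₀`
    have hW : ∀ W, G.IsMinContractible (Φ i) W → W ≠ S i → f₀ ∉ W := by
      intro W hWm hWS hf
      exact hWS (h.not_share hik.le hWm hSi
        (G.edgesAt_mono _ (Finset.singleton_subset_iff.2 hf) heF) heS)
    -- With at most three edges, `{f₀}` would be minimal contractible and share `e` with `S i`.
    have hfour : 4 ≤ (G.edgesAt (Φ i) {f₀}).card := by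
      by_contra! hlt
      obtain ⟨W, hWs, hWm⟩ := G.exists_isMinContractible (Φ := Φ i) (X := {f₀})
        (by simpa using hf₀) (by simp) (by simp; omega)
      have hWf : W = {f₀} := (Finset.subset_singleton_iff.1 hWs).resolve_left
        hWm.2.1.ne_empty
      exact hW W hWm (fun h0 => hf₀S (by rw [← h0, hWf]; simp)) (by simp [hWf])
    -- A single face takes at most one of the four edges, but at most two remain.
    have hS2 : 2 ≤ (S i).card := by
      by_contra! hlt
      have h1 : (S i).card = 1 := by
        have := Finset.card_pos.2 hSi.2.1
        omega
      obtain ⟨f, hf⟩ := Finset.card_eq_one.1 h1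
      have hle : (G.edgesAt (Φ i) {f₀} \ G.edgesAt (Φ (i + 1)) {f₀}).card ≤ 1 := by
        rw [Finset.card_le_one]
        have key : ∀ x ∈ G.edgesAt (Φ i) {f₀} \ G.edgesAt (Φ (i + 1)) {f₀},
            G.bd f₀ x ≠ 0 ∧ G.bd f x ≠ 0 := by
          intro x hx
          rw [Finset.mem_sdiff, hsucc, mem_edgesAt_sdiff, hf] at hx
          obtain ⟨hx1, hx2⟩ := hx
          have hx3 : x ∈ G.edgesAt (Φ i) {f} := by tauto
          obtain ⟨-, g, hg, hgx⟩ := mem_edgesAt.1 hx3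
          rw [Finset.mem_singleton] at hg
          exact ⟨((hbdF x).1 hx1).2, hg ▸ hgx⟩
        intro x hx y hy
        refine hG f₀ f (fun h0 => hf₀S ?_) x y (key x hx).1 (key x hx).2 (key y hy).1 (key y hy).2
        rw [hf, h0]; simp
      have h3 := Finset.le_card_sdiff (G.edgesAt (Φ (i + 1)) {f₀}) (G.edgesAt (Φ i) {f₀})
      rw [ih] at h3 hle
      omega
    have hSe : (G.edgesAt (Φ i) (S i)).card = 3 * (S i).card := by
      rcases h.card_eq_or_singleton hG hik with h0 | ⟨⟨f, hf⟩, -⟩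
      · exact h0
      · rw [hf, Finset.card_singleton] at hS2; omega
    obtain ⟨y, hy⟩ : (G.edgesAt (Φ (i + 1)) {f₀}).Nonempty := by
      by_contra h0
      rw [Finset.not_nonempty_iff_eq_empty] at h0
      refine h.not_isClosedIn hG (i + 1) hik {f₀} ⟨by simpa [hsucc] using ⟨hf₀, hf₀S⟩, by simp,
        fun x hx => ?_⟩
      rw [Finset.sum_singleton]
      by_contra hfx
      exact Finset.notMem_empty x (h0 ▸ mem_edgesAt.2 ⟨mem_edgesOf.1 hx, f₀, by simp, hfx⟩)
    have hy' := hy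
    rw [hsucc, mem_edgesAt_sdiff] at hy'
    let X := insert f₀ (S i)
    have hXcard : X.card = (S i).card + 1 := Finset.card_insert_of_notMem hf₀S
    have hXΦ : X ⊆ Φ i := Finset.insert_subset hf₀ hSi.1
    -- What keeps such a `C` from being closed in `Φ (i + 1)` is an edge of `f₀`. That edge survives
    -- to stage `l`, so some face of `C` does too, and `C ∩ Φ l` would be closed once `f₀` is
    -- contracted.
    have hcl : ∀ C, ¬ G.IsClosedIn (Φ i \ X) C := by
      intro C hC
      have hsd : Φ i \ X = Φ (i + 1) \ {f₀} := by
        rw [hsucc, sdiff_sdiff, Finset.sup_eq_union, Finset.union_comm]; rfl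
      rw [hsd] at hC
      have hC1 : C ⊆ Φ (i + 1) := hC.1.trans Finset.sdiff_subset
      obtain ⟨x, hx, hxC⟩ : ∃ x ∈ G.edgesOf (Φ (i + 1)), ∑ f ∈ C, G.bd f x ≠ 0 := by
        by_contra! h0
        exact h.not_isClosedIn hG (i + 1) hik C ⟨hC1, hC.2.1, h0⟩
      obtain ⟨g, hg, hgx⟩ := Finset.exists_ne_zero_of_sum_ne_zero hxC
      have hxF : x ∈ G.edgesAt (Φ l) {f₀} := by
        rw [← ih]
        by_contra hxF
        exact hxC (hC.2.2 x (mem_edgesOf_sdiff.2 ⟨hx, hxF⟩))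
      have hgl : g ∈ Φ l := by
        by_contra hgl
        exact hgx ((mem_edgesAt.1 hxF).1 g hgl)
      refine h.not_isClosedIn hG (l + 1) hl (C ∩ Φ l) ⟨?_, ⟨g, by simp [hg, hgl]⟩, fun z hz => ?_⟩
      · rw [h.succ l hl, hS]
        intro c hc
        rw [Finset.mem_inter] at hc
        exact Finset.mem_sdiff.2 ⟨hc.2, (Finset.mem_sdiff.1 (hC.1 hc.1)).2⟩
      · have hz' := hz
        rw [h.succ l hl, hS] at hz'
        rw [← hC.2.2 z (edgesOf_mono G (Finset.sdiff_subset_sdiff (h.subset_of_le hil hl.le)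
          subset_rfl) hz')]
        refine Finset.sum_subset Finset.inter_subset_left fun c hc hc' => ?_
        exact mem_edgesOf.1 (mem_edgesOf_sdiff.1 hz').1 c fun h0 => hc' (by simp [hc, h0])
    have hXe : (G.edgesAt (Φ i) X).card ≤ (G.edgesAt (Φ i) (S i)).card + 2 := by
      have hsub : G.edgesAt (Φ i) X ⊆ G.edgesAt (Φ i) (S i) ∪ G.edgesAt (Φ (i + 1)) {f₀} := by
        intro x hx
        obtain ⟨h1, g, hg, hgx⟩ := mem_edgesAt.1 hx
        rw [Finset.mem_union, hsucc, mem_edgesAt_sdiff]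
        by_cases hxS : x ∈ G.edgesAt (Φ i) (S i)
        · exact Or.inl hxS
        · refine Or.inr ⟨?_, hxS⟩
          rcases Finset.mem_insert.1 hg with rfl | h2
          · exact mem_edgesAt.2 ⟨h1, g, by simp, hgx⟩
          · exact absurd (mem_edgesAt.2 ⟨h1, g, h2, hgx⟩) hxS
      refine (Finset.card_le_card hsub).trans ((Finset.card_union_le _ _).trans ?_)
      rw [ih]
      omega
    -- The edges of `S i` and one surviving edge `y` of `f₀` number 3|S i| + 1, one more than the
    -- bound 3|X| - 3.
    have hfin := card_add_three_le hG hXΦ (by omega) hcl (I := insert y (G.edgesAt (Φ i) (S i)))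
      ?_ ?_
    · rw [Finset.card_insert_of_notMem hy'.2] at hfin
      omega
    · exact Finset.insert_subset
        (G.edgesAt_mono _ (Finset.singleton_subset_iff.2 (Finset.mem_insert_self _ _)) hy'.1)
        (G.edgesAt_mono _ (Finset.subset_insert _ _))
    · have hIX : insert y (G.edgesAt (Φ i) (S i)) ⊆ G.edgesAt (Φ i) X := Finset.insert_subset
        (G.edgesAt_mono _ (Finset.singleton_subset_iff.2 (Finset.mem_insert_self _ _)) hy'.1)
        (G.edgesAt_mono _ (Finset.subset_insert _ _))
      intro f hf x hx x' hx' hfx hfx' hp hp'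
      by_contra hxx
      rcases Finset.mem_insert.1 hf with rfl | hfS
      · have key : ∀ x ∈ insert y (G.edgesAt (Φ i) (S i)),
            (∀ g ∈ X, g ≠ f → G.bd g x = 0) → x = y := by
          intro x hx hp
          rcases Finset.mem_insert.1 hx with h0 | h0
          · exact h0
          · obtain ⟨-, g, hg, hgx⟩ := mem_edgesAt.1 h0
            exact absurd (hp g (Finset.mem_insert_of_mem hg) fun h1 => hf₀S (h1 ▸ hg)) hgx
        exact hxx ((key x hx hp).trans (key x' hx' hp').symm)
      -- Two private edges at `f` would make `X.erase f` contractible. A minimal contractible set in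
      -- it avoids `f` and also `f₀`, so it is a proper subset of `S i`.
      · have h7 := card_edgesAt_erase_add_two_le hxx (hIX hx) (hIX hx') hp hp'
        have hff : f₀ ≠ f := fun h0 => hf₀S (h0 ▸ hfS)
        obtain ⟨W, hWs, hWm⟩ := G.exists_isMinContractible (Φ := Φ i) (X := X.erase f)
          ((Finset.erase_subset _ _).trans hXΦ)
          ⟨f₀, Finset.mem_erase.2 ⟨hff, Finset.mem_insert_self _ _⟩⟩ (by
            rw [Finset.card_erase_of_mem hf, hXcard]
            omega)
        have hfW : f ∉ W := fun h0 => Finset.notMem_erase f _ (hWs h0)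
        have hWS : W ≠ S i := fun h0 => hfW (h0 ▸ hfS)
        have hf₀W := hW W hWm hWS
        refine absurd hWm.2.2.1 (not_le.2 (hSi.2.2.2 W ⟨?_, fun h0 => hfW (h0 hfS)⟩ hWm.2.1))
        intro c hc
        rcases Finset.mem_insert.1 (Finset.mem_erase.1 (hWs hc)).2 with rfl | h1
        · exact absurd hc hf₀W
        · exact h1

end IsContractionSeq

end Contraction
end PlaneGraph
namespace PlaneGraph

/-! ### Rado's theorem -/

section Transversal

variable {K W ι : Type*} [Field K] [AddCommGroup W] [Module K W] [FiniteDimensional K W]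

/-- **Rado's theorem** for subsets of a vector space, relative to a subspace. -/
lemma exists_transversal_finrank (A : ι → Set W) (s : Finset ι) : ∀ U : Submodule K W,
    (∀ t ⊆ s, Module.finrank K U + t.card ≤
      Module.finrank K ↥(U ⊔ Submodule.span K (⋃ i ∈ t, A i))) →
    ∃ w : ι → W, (∀ i ∈ s, w i ∈ A i) ∧
      Module.finrank K ↥(U ⊔ Submodule.span K (w '' s)) = Module.finrank K U + s.card := by
  classical
  induction s using Finset.strongInduction with
  | H s ih =>
    intro U hU
    rcases s.eq_empty_or_nonempty with rfl | ⟨i, hi⟩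
    · exact ⟨fun _ => 0, by simp,
        by rw [Finset.coe_empty, Set.image_empty, Submodule.span_empty, sup_bot_eq]; simp⟩
    -- A tight proper subset is solved first, and the rest modulo its span. Without one, there is a
    -- dimension to spare, and any vector of `A i` outside `U` may be chosen.
    by_cases htight : ∃ t, t ⊂ s ∧ t.Nonempty ∧
        Module.finrank K ↥(U ⊔ Submodule.span K (⋃ i ∈ t, A i)) ≤ Module.finrank K U + t.card
    · obtain ⟨t, hts, htne, hle⟩ := htight
      obtain ⟨w, hw, hwr⟩ := ih t hts U fun r hr => hU r (hr.trans hts.subset)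
      have hUeq : U ⊔ Submodule.span K (w '' t) = U ⊔ Submodule.span K (⋃ i ∈ t, A i) := by
        apply Submodule.eq_of_le_of_finrank_le
        · refine sup_le_sup_left (Submodule.span_mono ?_) U
          rintro _ ⟨j, hj, rfl⟩
          exact Set.mem_biUnion hj (hw j hj)
        · rw [hwr]; exact hle
      obtain ⟨w', hw', hwr'⟩ := ih (s \ t) (Finset.sdiff_ssubset hts.subset htne)
        (U ⊔ Submodule.span K (w '' t)) (by
          intro r hr
          have h1 := hU (t ∪ r) (Finset.union_subset hts.subset (hr.trans Finset.sdiff_subset))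
          have hd : Disjoint t r := Finset.disjoint_of_subset_right hr Finset.disjoint_sdiff
          rw [Finset.card_union_of_disjoint hd, Finset.set_biUnion_union, Submodule.span_union,
            ← sup_assoc, ← hUeq] at h1
          rw [hwr]
          omega)
      refine ⟨fun j => if j ∈ t then w j else w' j, fun j hj => ?_, ?_⟩
      · by_cases hjt : j ∈ t
        · simpa [hjt] using hw j hjt
        · simpa [hjt] using hw' j (by simp [hj, hjt])
      · have himg : (fun j => if j ∈ t then w j else w' j) '' s =
            w '' t ∪ w' '' (s \ t : Finset ι) := by
          ext x
          constructor
          · rintro ⟨j, hj, rfl⟩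
            by_cases hjt : j ∈ t
            · exact Or.inl ⟨j, hjt, by simp [hjt]⟩
            · exact Or.inr ⟨j, by simpa [hjt] using hj, by simp [hjt]⟩
          · rintro (⟨j, hj, rfl⟩ | ⟨j, hj, rfl⟩)
            · exact ⟨j, hts.subset hj, by simp [Finset.mem_coe.1 hj]⟩
            · have hj' := Finset.mem_sdiff.1 (Finset.mem_coe.1 hj)
              exact ⟨j, hj'.1, by simp [hj'.2]⟩
        rw [himg, Submodule.span_union, ← sup_assoc, hwr', hwr,
          Finset.card_sdiff_of_subset hts.subset]
        have := Finset.card_le_card hts.subset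
        omega
    · push Not at htight
      obtain ⟨x, hx, hxU⟩ : ∃ x ∈ A i, x ∉ U := by
        by_contra! h0
        have h1 := hU {i} (by simpa using hi)
        rw [Finset.set_biUnion_singleton, sup_eq_left.2 (Submodule.span_le.2 h0),
          Finset.card_singleton] at h1
        omega
      have hlt : Module.finrank K U < Module.finrank K ↥(U ⊔ Submodule.span K {x}) := by
        apply Submodule.finrank_lt_finrank_of_lt
        refine lt_of_le_of_ne le_sup_left fun h0 => hxU ?_
        rw [h0]
        exact (le_sup_right : _ ≤ U ⊔ Submodule.span K {x}) (Submodule.mem_span_singleton_self x)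
      have hle : Module.finrank K ↥(U ⊔ Submodule.span K {x}) ≤ Module.finrank K U + 1 :=
        (Submodule.finrank_add_le_finrank_add_finrank _ _).trans
          (Nat.add_le_add_left (by simpa using finrank_span_le_card (R := K) ({x} : Set W)) _)
      obtain ⟨w, hw, hwr⟩ := ih (s.erase i) (Finset.erase_ssubset hi)
        (U ⊔ Submodule.span K {x}) (by
          intro r hr
          rcases r.eq_empty_or_nonempty with rfl | hne
          · rw [Finset.card_empty, add_zero]
            exact Submodule.finrank_mono le_sup_left
          have h1 := htight r ((Finset.ssubset_of_subset_of_ssubset hr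
            (Finset.erase_ssubset hi))) hne
          have h2 : Module.finrank K ↥(U ⊔ Submodule.span K (⋃ i ∈ r, A i)) ≤
              Module.finrank K ↥(U ⊔ Submodule.span K {x} ⊔ Submodule.span K (⋃ i ∈ r, A i)) :=
            Submodule.finrank_mono (sup_le_sup_right le_sup_left _)
          omega)
      refine ⟨Function.update w i x, fun j hj => ?_, ?_⟩
      · by_cases hji : j = i
        · subst hji; simpa using hx
        · simpa [hji] using hw j (by simp [hj, hji])
      · have himg : Function.update w i x '' s = {x} ∪ w '' (s.erase i : Finset ι) := by
          ext z
          constructor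
          · rintro ⟨j, hj, rfl⟩
            by_cases hji : j = i
            · subst hji; simp
            · exact Or.inr ⟨j, by simpa [hji] using hj, by simp [hji]⟩
          · rintro (rfl | ⟨j, hj, rfl⟩)
            · exact ⟨i, hi, by simp⟩
            · have hj' := Finset.mem_erase.1 (Finset.mem_coe.1 hj)
              exact ⟨j, hj'.2, by simp [hj'.1]⟩
        rw [himg, Submodule.span_union, ← sup_assoc, hwr, Finset.card_erase_of_mem hi]
        have := Finset.card_pos.2 ⟨i, hi⟩
        omega

end Transversal

/-! ### Generic rank of one block -/

section GenericRank

variable {V E F : Type*} [Fintype V] [Fintype E] [Fintype F] {K : Type*} [Field K]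

/-- The extended cycle basis matrix with the rows of the faces in `Φ` and the columns of the edges
in `Ε`. -/
noncomputable def labelMatrix (G : PlaneGraph V E F) (a : E → K) (Φ : Finset F) (Ε : Finset E) :
    Matrix (Φ × Fin 3) Ε K :=
  fun r e => (G.bd r.1 e : K) * a e ^ (r.2 : ℕ)

open scoped Classical in
/-- The combinatorial inequality behind the generic rank: the edges in `X` are bounded by the number
of classes into which they divide the faces. -/
lemma card_add_three_mul_classes_le {G : PlaneGraph V E F} (hG : G.ShareAtMostOneEdge)
    {Φ : Finset F} {Ε X : Finset E} (htouch : ∀ e ∈ Ε, ∃ f ∈ Φ, G.bd f e ≠ 0)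
    (hproper : ∀ T, T ⊂ Φ → T.Nonempty →
      3 * T.card < (Ε.filter (fun e => ∃ f ∈ T, G.bd f e ≠ 0)).card)
    (hX : X ⊆ Ε) (s : Setoid (Option F)) (hs : ∀ e ∈ X, s (G.side (e, true)) (G.side (e, false)))
    (hnone : ∀ f ∉ Φ, s none (some f)) :
    X.card + 3 * ((Φ.filter (fun f => ¬ s (some f) none)).image
      (fun f => (Quotient.mk s (some f)))).card ≤ 3 * Φ.card + (Ε.card - 3 * Φ.card) := by
  set T := Φ.filter (fun f => ¬ s (some f) none) with hT
  set R := T.image (fun f => (Quotient.mk s (some f))) with hR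
  have hmemT : ∀ f, f ∈ T ↔ ¬ s (some f) none := by
    intro f
    rw [hT, Finset.mem_filter, and_iff_right_iff_imp]
    intro h
    by_contra hf
    exact h (s.symm (hnone f hf))
  let C : Quotient s → Finset F := fun q => T.filter (fun f => Quotient.mk s (some f) = q)
  let sh : Finset F → Finset E := fun B => Finset.univ.filter
    (fun e => ∃ f ∈ B, ∃ f' ∈ B, f ≠ f' ∧ G.bd f e ≠ 0 ∧ G.bd f' e ≠ 0)
  -- Both sides of an edge of `X` lie in one class, so an edge at `T` is shared by two faces of its
  -- class; the planar bound then applies class by class.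
  have hX1 : X.filter (fun e => ∃ f ∈ T, G.bd f e ≠ 0) ⊆ R.biUnion (fun q => sh (C q)) := by
    intro e he
    obtain ⟨heX, f, hf, hfe⟩ := Finset.mem_filter.1 he
    have hother : ∃ o : Option F, s (some f) o ∧ o ≠ some f ∧
        ∀ g, o = some g → G.bd g e ≠ 0 := by
      rcases (G.bd_ne_zero_iff f e).1 hfe with ⟨h1, h2⟩ | ⟨h1, h2⟩
      · refine ⟨_, h1 ▸ hs e heX, h2, fun g hg => (G.bd_ne_zero_iff g e).2 (Or.inr ⟨hg, ?_⟩)⟩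
        rw [h1]; rintro h3; exact h2 (hg.trans h3.symm)
      · refine ⟨_, s.symm (h1 ▸ hs e heX), h2,
          fun g hg => (G.bd_ne_zero_iff g e).2 (Or.inl ⟨hg, ?_⟩)⟩
        rw [h1]; rintro h3; exact h2 (hg.trans h3.symm)
    obtain ⟨o, ho, hof, hbd⟩ := hother
    cases o with
    | none => exact absurd ho ((hmemT f).1 hf)
    | some g =>
      have hg : g ∈ T := (hmemT g).2 fun h0 => (hmemT f).1 hf (s.trans ho h0)
      have hq : (Quotient.mk s (some g)) = Quotient.mk s (some f) := Quotient.sound (s.symm ho)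
      refine Finset.mem_biUnion.2 ⟨Quotient.mk s (some f), Finset.mem_image_of_mem _ hf, ?_⟩
      refine Finset.mem_filter.2 ⟨Finset.mem_univ _, f, Finset.mem_filter.2 ⟨hf, rfl⟩, g,
        Finset.mem_filter.2 ⟨hg, hq⟩, fun h0 => hof (by rw [h0]), hfe, hbd g rfl⟩
  have hX1card : (X.filter (fun e => ∃ f ∈ T, G.bd f e ≠ 0)).card + 3 * R.card ≤ 3 * T.card := by
    calc (X.filter (fun e => ∃ f ∈ T, G.bd f e ≠ 0)).card + 3 * R.card
        ≤ ∑ q ∈ R, (sh (C q)).card + ∑ q ∈ R, 3 := by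
          refine Nat.add_le_add ((Finset.card_le_card hX1).trans Finset.card_biUnion_le) ?_
          simp [mul_comm]
      _ = ∑ q ∈ R, ((sh (C q)).card + 3) := Finset.sum_add_distrib.symm
      _ ≤ ∑ q ∈ R, 3 * (C q).card := by
          refine Finset.sum_le_sum fun q hq => card_shared_add_three_le hG ?_
          obtain ⟨f, hf, rfl⟩ := Finset.mem_image.1 hq
          exact ⟨f, Finset.mem_filter.2 ⟨hf, rfl⟩⟩
      _ = 3 * T.card := by
          rw [← Finset.mul_sum, Finset.card_eq_sum_card_image (fun f => Quotient.mk s (some f)) T]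
  have hsplit := Finset.card_filter_add_card_filter_not (s := X)
    (fun e => ∃ f ∈ T, G.bd f e ≠ 0)
  have hX0 : (X.filter (fun e => ¬ ∃ f ∈ T, G.bd f e ≠ 0)).card +
      (Ε.filter (fun e => ∃ f ∈ T, G.bd f e ≠ 0)).card ≤ Ε.card := by
    have h1 := Finset.card_filter_add_card_filter_not (s := Ε) (fun e => ∃ f ∈ T, G.bd f e ≠ 0)
    have h2 := Finset.card_le_card (Finset.filter_subset_filter
      (fun e => ¬ ∃ f ∈ T, G.bd f e ≠ 0) hX)
    omega
  -- The edges of `X` away from `T` are at most those of `Ε` away from `T`: fewer than |Ε| - 3|T| if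
  -- `T` is proper and nonempty, and none if `T = Φ` is nonempty.
  rcases T.eq_empty_or_nonempty with h0 | hne
  · rw [h0] at hX1card
    simp only [Finset.card_empty] at hX1card
    have := Finset.card_le_card hX
    omega
  · by_cases hTΦ : T = Φ
    · have h1 : Ε.filter (fun e => ∃ f ∈ T, G.bd f e ≠ 0) = Ε :=
        Finset.filter_true_of_mem fun e he => by rw [hTΦ]; exact htouch e he
      rw [h1] at hX0
      rw [hTΦ] at hX1card
      rw [hTΦ] at hX0 hsplit
      omega
    · have h1 := hproper T ((Finset.filter_subset _ _).ssubset_of_ne hTΦ) hne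
      omega

open scoped Classical in
/-- If every proper nonempty set of faces has more than three times as many edges, then the extended
cycle basis matrix has maximal rank for suitable labels. -/
lemma exists_rank_labelMatrix_ge [CharZero K] {G : PlaneGraph V E F} (hG : G.ShareAtMostOneEdge)
    {Φ : Finset F} {Ε : Finset E} (htouch : ∀ e ∈ Ε, ∃ f ∈ Φ, G.bd f e ≠ 0)
    (hproper : ∀ T, T ⊂ Φ → T.Nonempty →
      3 * T.card < (Ε.filter (fun e => ∃ f ∈ T, G.bd f e ≠ 0)).card) :
    ∃ b : E → K, min Ε.card (3 * Φ.card) ≤ (G.labelMatrix b Φ Ε).rank := by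
  -- Padding with `d` free coordinates raises the dimension to the maximum of |Ε| and 3|Φ|, so that
  -- all columns can be made independent at once.
  let d := Ε.card - 3 * Φ.card
  let W := ((Φ × Fin 3) → K) × (Fin d → K)
  let col : E → K → (Φ × Fin 3) → K := fun e b r => (G.bd r.1 e : K) * b ^ (r.2 : ℕ)
  let A : E → Set W := fun e => Set.range (fun p : K × (Fin d → K) => (col e p.1, p.2))
  have hW : Module.finrank K W = 3 * Φ.card + d := by
    simp [W, mul_comm]
  obtain ⟨w, hw, hwr⟩ := exists_transversal_finrank (K := K) A Ε ⊥ (by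
    intro X hX
    rw [bot_sup_eq, finrank_bot, zero_add]
    rcases X.eq_empty_or_nonempty with rfl | ⟨e₀, he₀⟩
    · simp
    -- Faces joined through edges of `X`. Faces outside `Φ` have no rows and count as unbounded.
    let s : Setoid (Option F) := Relation.EqvGen.setoid (fun o o' =>
      (∃ e ∈ X, o = G.side (e, true) ∧ o' = G.side (e, false)) ∨
        ∃ f ∉ Φ, o = none ∧ o' = some f)
    let vec : Option F → Fin 3 → W := fun o t => o.elim 0
      (fun f => if h : f ∈ Φ then (Pi.single (⟨f, h⟩, t) 1, 0) else 0)
    set T := Φ.filter (fun f => ¬ s (some f) none)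
    set R := T.image (fun f => (Quotient.mk s (some f)))
    have hcount : X.card + 3 * R.card ≤ 3 * Φ.card + d :=
      card_add_three_mul_classes_le hG htouch hproper hX s
        (fun e he => Relation.EqvGen.rel _ _ (Or.inl ⟨e, he, rfl, rfl⟩))
        (fun f hf => Relation.EqvGen.rel _ _ (Or.inr ⟨f, hf, rfl, rfl⟩))
    set D := Submodule.span K (⋃ i ∈ X, A i) with hD
    have hmemA : ∀ φ ∈ D.dualAnnihilator, ∀ e ∈ X, ∀ b u, φ (col e b, u) = 0 := by
      intro φ hφ e he b u
      exact (Submodule.mem_dualAnnihilator φ).1 hφ _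
        (Submodule.subset_span (Set.mem_biUnion he ⟨(b, u), rfl⟩))
    have hu : ∀ φ ∈ D.dualAnnihilator, ∀ u, φ (0, u) = 0 := by
      intro φ hφ u
      have h1 := hmemA φ hφ e₀ he₀ 0 u
      have h2 := hmemA φ hφ e₀ he₀ 0 0
      have h3 : ((0, u) : W) = (col e₀ 0, u) - (col e₀ 0, 0) := by ext <;> simp
      rw [h3, map_sub, h1, h2, sub_zero]
    have hsum : ∀ φ : Module.Dual K W, ∀ e b, φ (col e b, 0) =
        ∑ t : Fin 3, b ^ (t : ℕ) * ((G.side (e, true)).elim 0 (fun f => φ (vec (some f) t)) -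
          (G.side (e, false)).elim 0 (fun f => φ (vec (some f) t))) := by
      intro φ e b
      simp only [← sum_mul_bd]
      have h1 : ((col e b, 0) : W) = ∑ r : Φ × Fin 3, col e b r •
          ((Pi.single r 1, 0) : W) := by
        ext i
        · simp [Prod.fst_sum, Finset.sum_apply, Pi.single_apply]
        · simp [Prod.snd_sum]
      rw [h1, map_sum, Fintype.sum_prod_type_right]
      refine Finset.sum_congr rfl fun t _ => ?_
      have h2 : ∑ f, φ (vec (some f) t) * (G.bd f e : K) =
          ∑ f : Φ, φ (vec (some f.1) t) * (G.bd f.1 e : K) := by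
        rw [Finset.sum_coe_sort Φ (fun f => φ (vec (some f) t) * (G.bd f e : K))]
        refine (Finset.sum_subset (Finset.subset_univ Φ) fun f _ hf => ?_).symm
        simp [vec, hf]
      rw [h2, Finset.mul_sum]
      refine Finset.sum_congr rfl fun f _ => ?_
      simp only [vec, Option.elim, f.2, dite_true, map_smul, smul_eq_mul, col]
      ring
    have hedge : ∀ φ ∈ D.dualAnnihilator, ∀ e ∈ X, ∀ t,
        φ (vec (G.side (e, true)) t) = φ (vec (G.side (e, false)) t) := by
      intro φ hφ e he t
      have helim : ∀ o : Option F, ∀ t,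
          o.elim 0 (fun f => φ (vec (some f) t)) = φ (vec o t) := by
        intro o t
        cases o <;> simp [vec]
      -- A quadratic polynomial in the label that vanishes at 0, 1 and -1 has zero coefficients, as
      -- 2 ≠ 0.
      have h0 := hsum φ e 0
      have h1 := hsum φ e 1
      have h2 := hsum φ e (-1)
      rw [hmemA φ hφ e he] at h0 h1 h2
      simp only [helim, Fin.sum_univ_three] at h0 h1 h2
      norm_num at h0 h1 h2
      rw [← sub_eq_zero]
      have two : (2 : K) ≠ 0 := two_ne_zero
      have e2 : φ (vec (G.side (e, true)) 2) - φ (vec (G.side (e, false)) 2) = 0 := by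
        apply mul_left_cancel₀ two
        linear_combination -h1 - h2 + 2 * h0
      fin_cases t
      · exact h0.symm
      · show φ (vec (G.side (e, true)) 1) - φ (vec (G.side (e, false)) 1) = 0
        linear_combination -h1 + h0 - e2
      · exact e2
    have hclass : ∀ φ ∈ D.dualAnnihilator, ∀ o o', s o o' → ∀ t, φ (vec o t) = φ (vec o' t) := by
      intro φ hφ o o' ho t
      induction ho with
      | rel o o' h =>
        rcases h with ⟨e, he, rfl, rfl⟩ | ⟨f, hf, rfl, rfl⟩
        · exact hedge φ hφ e he t
        · simp [vec, hf]
      | refl => rfl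
      | symm _ _ _ ih => exact ih.symm
      | trans _ _ _ _ _ ih1 ih2 => exact ih1.trans ih2
    -- A functional that kills all columns is given by three values on each class away from the
    -- unbounded face, so the annihilator has dimension at most 3|R|.
    let ev : Module.Dual K W →ₗ[K] (R × Fin 3 → K) :=
      LinearMap.pi (fun p => Module.Dual.eval K W (vec (Quotient.out p.1.1) p.2))
    have hinj : Function.Injective (ev ∘ₗ D.dualAnnihilator.subtype) := by
      rw [injective_iff_map_eq_zero]
      rintro ⟨φ, hφ⟩ h0
      have hv : ∀ o t, φ (vec o t) = 0 := by
        intro o t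
        by_cases ho : s o none
        · rw [hclass φ hφ o none ho]; simp [vec]
        · cases o with
          | none => exact absurd (s.refl none) ho
          | some f =>
            have hf : f ∈ T := by
              refine Finset.mem_filter.2 ⟨?_, ho⟩
              by_contra hf
              exact ho (s.symm (Relation.EqvGen.rel _ _ (Or.inr ⟨f, hf, rfl, rfl⟩)))
            have := congrFun h0 (⟨Quotient.mk s (some f), Finset.mem_image_of_mem _ hf⟩, t)
            rw [hclass φ hφ (some f) _ (Setoid.symm' s (Quotient.mk_out (some f)))]
            exact this
      ext1
      show φ = 0
      apply LinearMap.prod_ext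
      · refine LinearMap.pi_ext' fun r => LinearMap.ext_ring ?_
        simpa [vec] using hv (some r.1.1) r.2
      · ext u
        simpa using hu φ hφ _
    have h1 := LinearMap.finrank_le_finrank_of_injective hinj
    have h2 := Subspace.finrank_add_finrank_dualAnnihilator_eq D
    rw [hW] at h2
    simp only [Module.finrank_fintype_fun_eq_card, Fintype.card_prod, Fintype.card_coe,
      Fintype.card_fin] at h1
    omega)
  choose! p hp using hw
  refine ⟨fun e => (p e).1, ?_⟩
  rw [bot_sup_eq, finrank_bot, zero_add] at hwr
  set N := G.labelMatrix (fun e => (p e).1) Φ Ε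
  rw [Matrix.rank_eq_finrank_span_cols]
  set B := Submodule.span K (Set.range N.col)
  have hle : Submodule.span K (w '' Ε) ≤ B.prod (⊤ : Submodule K (Fin d → K)) := by
    rw [Submodule.span_le]
    rintro _ ⟨e, he, rfl⟩
    rw [← hp e he]
    exact ⟨Submodule.subset_span ⟨⟨e, he⟩, rfl⟩, trivial⟩
  have h1 := Submodule.finrank_mono hle
  -- Dropping the padding costs at most `d`.
  have h2 : Module.finrank K (B.prod (⊤ : Submodule K (Fin d → K))) ≤ Module.finrank K B + d := by
    rw [LinearMap.prod_eq_sup_map]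
    refine (Submodule.finrank_add_le_finrank_add_finrank _ _).trans
      (Nat.add_le_add (Submodule.finrank_map_le _ _) ((Submodule.finrank_map_le _ _).trans ?_))
    simp
  have h3 : Ε.card ≤ Module.finrank K B + d := (hwr.symm.le.trans h1).trans h2
  omega

end GenericRank
end PlaneGraph

/-! ### Rank inequalities and degeneracy loci -/

section MatrixRank

variable {K : Type*} [Field K] {m n : Type*} [Fintype n]

open scoped Classical in
-- Rank-nullity for `D` on the range of `N`: its kernel contains the range of `N * D'`.
lemma Matrix.rank_mul_add_rank_mul_le {l o : Type*} [Fintype m] [Fintype o] (D : Matrix l m K)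
    (N : Matrix m n K) (D' : Matrix n o K) (h : D * N * D' = 0) :
    (D * N).rank + (N * D').rank ≤ N.rank := by
  let π := D.mulVecLin.domRestrict (LinearMap.range N.mulVecLin)
  have h1 := LinearMap.finrank_range_add_finrank_ker π
  have h2 : LinearMap.range π = LinearMap.range (D * N).mulVecLin := by
    rw [Matrix.mulVecLin_mul, LinearMap.range_comp, LinearMap.range_domRestrict]
  have h3 : LinearMap.range (N * D').mulVecLin ≤
      (LinearMap.ker π).map (LinearMap.range N.mulVecLin).subtype := by
    rintro _ ⟨x, rfl⟩
    refine ⟨⟨(N * D').mulVecLin x, ⟨D'.mulVecLin x, by simp⟩⟩, ?_, rfl⟩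
    change D.mulVecLin ((N * D').mulVecLin x) = 0
    simp [Matrix.mulVec_mulVec, ← Matrix.mul_assoc, h]
  have h4 := (Submodule.finrank_mono h3).trans (Submodule.finrank_map_le _ _)
  rw [h2] at h1
  unfold Matrix.rank
  omega

lemma Matrix.rank_add_le (A B : Matrix m n K) : (A + B).rank ≤ A.rank + B.rank := by
  have h : LinearMap.range (A + B).mulVecLin ≤
      LinearMap.range A.mulVecLin ⊔ LinearMap.range B.mulVecLin := by
    rw [Matrix.mulVecLin_add]
    rintro _ ⟨x, rfl⟩
    exact Submodule.add_mem_sup ⟨x, rfl⟩ ⟨x, rfl⟩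
  exact (Submodule.finrank_mono h).trans (Submodule.finrank_add_le_finrank_add_finrank _ _)

/-- A matrix contains as many linearly independent columns as its rank. -/
lemma Matrix.exists_linearIndependent_cols (N : Matrix m n K) :
    ∃ c : Fin N.rank → n, Function.Injective c ∧ LinearIndependent K (fun i => N.col (c i)) := by
  obtain ⟨κ, c, hc, hspan, hli⟩ := exists_linearIndependent' K N.col
  have : Fintype κ := Fintype.ofInjective c hc
  have hcard : Fintype.card κ = N.rank := by
    rw [Matrix.rank_eq_finrank_span_cols, ← hspan, finrank_span_eq_card hli]
  let e : Fin N.rank ≃ κ := (Fintype.equivFinOfCardEq hcard).symm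
  exact ⟨c ∘ e, hc.comp e.injective, hli.comp e e.injective⟩

open scoped Classical in
/-- The rank of a matrix of polynomials does not drop where a suitable polynomial is nonzero. -/
lemma Matrix.exists_eval_ne_zero_imp_rank_le [Fintype m] {σ : Type*} (N : Matrix m n (MvPolynomial σ K))
    (b : σ → K) : ∃ p : MvPolynomial σ K, MvPolynomial.eval b p ≠ 0 ∧
      ∀ a, MvPolynomial.eval a p ≠ 0 →
        (N.map (MvPolynomial.eval b)).rank ≤ (N.map (MvPolynomial.eval a)).rank := by
  obtain ⟨c, hc, hli⟩ := (N.map (MvPolynomial.eval b)).exists_linearIndependent_cols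
  let L := N.submatrix id c
  have hinj : Function.Injective (L.map (MvPolynomial.eval b)).mulVecLin :=
    Matrix.mulVec_injective_iff.2 hli
  -- A constant left inverse of the chosen columns at `b`; the determinant of its product with these
  -- columns is a polynomial with value 1 at `b`.
  obtain ⟨g, hg⟩ := LinearMap.exists_leftInverse_of_injective _ (LinearMap.ker_eq_bot.2 hinj)
  let P := LinearMap.toMatrix' g
  have hP : P * L.map (MvPolynomial.eval b) = 1 := by
    apply Matrix.toLin'.injective
    rw [Matrix.toLin'_mul, Matrix.toLin'_toMatrix', Matrix.toLin'_one]
    exact hg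
  let P' : Matrix (Fin (N.map (MvPolynomial.eval b)).rank) m (MvPolynomial σ K) :=
    P.map MvPolynomial.C
  have hev : ∀ a, MvPolynomial.eval a (P' * L).det =
      (P * L.map (MvPolynomial.eval a)).det := by
    intro a
    rw [RingHom.map_det, RingHom.mapMatrix_apply, Matrix.map_mul, Matrix.map_map]
    congr 2
    ext i j
    simp
  refine ⟨(P' * L).det, ?_, fun a ha => ?_⟩
  · rw [hev, hP, Matrix.det_one]
    exact one_ne_zero
  · rw [hev] at ha
    have h1 := Matrix.rank_of_det_ne_zero ha
    rw [Fintype.card_fin] at h1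
    calc _ = _ := h1.symm
      _ ≤ (L.map (MvPolynomial.eval a)).rank := Matrix.rank_mul_le_right _ _
      _ ≤ _ := Matrix.rank_submatrix_le (N.map (MvPolynomial.eval a)) id c

/-- The locus where a matrix of polynomials has small rank is an algebraic variety. -/
lemma isAlgebraicVariety_rank_lt [Fintype m] {σ : Type*} (N : Matrix m n (MvPolynomial σ K)) (r : ℕ) :
    IsAlgebraicVariety {a : σ → K | (N.map (MvPolynomial.eval a)).rank < r} := by
  -- All polynomials vanishing on the locus; at each point outside it the previous lemma supplies
  -- one that is nonzero.
  refine ⟨{p | ∀ a, (N.map (MvPolynomial.eval a)).rank < r → MvPolynomial.eval a p = 0},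
    Set.Subset.antisymm ?_ ?_⟩
  · intro a ha
    exact Set.mem_iInter₂.2 fun p hp => hp a ha
  · intro b hb
    by_contra hr
    obtain ⟨p, hp, hle⟩ := N.exists_eval_ne_zero_imp_rank_le b
    refine hp (Set.mem_iInter₂.1 hb p fun a ha => ?_)
    by_contra hpa
    exact hr ((hle a hpa).trans_lt ha)

end MatrixRank

namespace PlaneGraph

/-! ### Ranks of blocks of the extended cycle basis matrix -/

section LabelRank

variable {V E F : Type*} [Fintype V] [Fintype E] [Fintype F] {K : Type*} [Field K]

open scoped Classical in
/-- The extended cycle basis matrix in which all entries outside the rows of `Φ` and the columns of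
`Ε` are replaced by zero. -/
noncomputable def maskedMatrix (G : PlaneGraph V E F) (a : E → K) (Φ : Finset F) (Ε : Finset E) :
    Matrix (F × Fin 3) E K :=
  Matrix.of fun r e => if r.1 ∈ Φ ∧ e ∈ Ε then (G.bd r.1 e : K) * a e ^ (r.2 : ℕ) else 0

lemma rank_maskedMatrix (G : PlaneGraph V E F) (a : E → K) (Φ : Finset F) (Ε : Finset E) :
    (G.maskedMatrix a Φ Ε).rank = (G.labelMatrix a Φ Ε).rank := by
  classical
  apply le_antisymm
  · let A : Matrix (F × Fin 3) (Φ × Fin 3) K := Matrix.of fun i r =>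
      if (r.1.1, r.2) = i then 1 else 0
    let B : Matrix Ε E K := Matrix.of fun e j => if e.1 = j then 1 else 0
    have h : G.maskedMatrix a Φ Ε = A * G.labelMatrix a Φ Ε * B := by
      ext ⟨f, t⟩ e
      rw [Matrix.mul_apply]
      simp only [maskedMatrix, Matrix.of_apply]
      by_cases he : e ∈ Ε
      · rw [Finset.sum_eq_single ⟨e, he⟩ (by rintro ⟨x, hx⟩ _ h0; simp_all [B]) (by simp),
          Matrix.mul_apply]
        by_cases hf : f ∈ Φ
        · rw [Finset.sum_eq_single (⟨f, hf⟩, t)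
            (by rintro ⟨⟨x, hx⟩, s⟩ _ h0; simp_all [A]) (by simp)]
          simp [A, B, hf, he, labelMatrix]
        · rw [Finset.sum_eq_zero]
          · simp [hf]
          · rintro ⟨⟨x, hx⟩, s⟩ _
            have : x ≠ f := fun h0 => hf (h0 ▸ hx)
            simp [A, this]
      · rw [Finset.sum_eq_zero]
        · simp [he]
        · rintro ⟨x, hx⟩ _
          have : x ≠ e := fun h0 => he (h0 ▸ hx)
          simp [B, this]
    rw [h]
    exact (Matrix.rank_mul_le_left _ _).trans (Matrix.rank_mul_le_right _ _)
  · have h : G.labelMatrix a Φ Ε =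
        (G.maskedMatrix a Φ Ε).submatrix (fun r => (r.1.1, r.2)) Subtype.val := by
      ext r e
      simp [maskedMatrix, labelMatrix]
    rw [h]
    exact Matrix.rank_submatrix_le _ _ _

lemma rank_labelMatrix_le_faces (G : PlaneGraph V E F) (a : E → K) (Φ : Finset F) (Ε : Finset E) :
    (G.labelMatrix a Φ Ε).rank ≤ 3 * Φ.card := by
  refine (Matrix.rank_le_card_height _).trans (le_of_eq ?_)
  simp [mul_comm]

lemma rank_labelMatrix_le_edges (G : PlaneGraph V E F) (a : E → K) (Φ : Finset F) (Ε : Finset E) :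
    (G.labelMatrix a Φ Ε).rank ≤ Ε.card := by
  refine (Matrix.rank_le_card_width _).trans (le_of_eq ?_)
  simp

open scoped Classical in
lemma rank_labelMatrix_union_faces_le (G : PlaneGraph V E F) (a : E → K) {Φ Ψ : Finset F}
    (h : Disjoint Φ Ψ) (Ε : Finset E) :
    (G.labelMatrix a (Φ ∪ Ψ) Ε).rank ≤
      (G.labelMatrix a Φ Ε).rank + (G.labelMatrix a Ψ Ε).rank := by
  simp only [← rank_maskedMatrix]
  refine le_trans (le_of_eq ?_) (Matrix.rank_add_le _ _)
  congr 1
  ext r e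
  have := fun hr : r.1 ∈ Φ => Finset.disjoint_left.1 h hr
  simp only [maskedMatrix, Matrix.add_apply, Matrix.of_apply, Finset.mem_union]
  by_cases h1 : r.1 ∈ Φ <;> by_cases h2 : r.1 ∈ Ψ <;> by_cases h3 : e ∈ Ε <;> simp_all

open scoped Classical in
lemma rank_labelMatrix_union_edges_le (G : PlaneGraph V E F) (a : E → K) (Φ : Finset F)
    {Ε Ε' : Finset E} (h : Disjoint Ε Ε') :
    (G.labelMatrix a Φ (Ε ∪ Ε')).rank ≤
      (G.labelMatrix a Φ Ε).rank + (G.labelMatrix a Φ Ε').rank := by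
  simp only [← rank_maskedMatrix]
  refine le_trans (le_of_eq ?_) (Matrix.rank_add_le _ _)
  congr 1
  ext r e
  have := fun he : e ∈ Ε => Finset.disjoint_left.1 h he
  simp only [maskedMatrix, Matrix.add_apply, Matrix.of_apply, Finset.mem_union]
  by_cases h1 : e ∈ Ε <;> by_cases h2 : e ∈ Ε' <;> by_cases h3 : r.1 ∈ Φ <;> simp_all

/-- Rows and columns in which all entries vanish do not matter. -/
lemma rank_labelMatrix_congr (G : PlaneGraph V E F) (a : E → K) {Φ Φ' : Finset F}
    {Ε Ε' : Finset E}
    (h : ∀ f e, G.bd f e ≠ 0 → (f ∈ Φ ∧ e ∈ Ε ↔ f ∈ Φ' ∧ e ∈ Ε')) :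
    (G.labelMatrix a Φ Ε).rank = (G.labelMatrix a Φ' Ε').rank := by
  classical
  simp only [← rank_maskedMatrix]
  congr 1
  ext r e
  simp only [maskedMatrix, Matrix.of_apply]
  by_cases h0 : G.bd r.1 e = 0
  · simp [h0]
  · simp only [h r.1 e h0]

open scoped Classical in
/-- The rank of a block triangular matrix. -/
lemma add_rank_labelMatrix_le (G : PlaneGraph V E F) (a : E → K) {Φ Ψ : Finset F}
    {Ε Ε' : Finset E} (h : Disjoint Φ Ψ)
    (h0 : ∀ f ∈ Φ, ∀ e ∈ Ε', G.bd f e = 0) :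
    (G.labelMatrix a Φ Ε).rank + (G.labelMatrix a Ψ Ε').rank ≤
      (G.labelMatrix a (Φ ∪ Ψ) (Ε ∪ Ε')).rank := by
  simp only [← rank_maskedMatrix]
  set N := G.maskedMatrix a (Φ ∪ Ψ) (Ε ∪ Ε')
  let D : Matrix (F × Fin 3) (F × Fin 3) K := Matrix.diagonal fun r => if r.1 ∈ Φ then 1 else 0
  let D' : Matrix E E K := Matrix.diagonal fun e => if e ∈ Ε' then 1 else 0
  have hΨ : ∀ {f}, f ∈ Φ → f ∉ Ψ := fun {f} hf => Finset.disjoint_left.1 h hf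
  have h1 : D * N = G.maskedMatrix a Φ Ε := by
    ext r e
    rw [Matrix.diagonal_mul]
    by_cases h1 : r.1 ∈ Φ <;> by_cases h2 : e ∈ Ε <;> by_cases h3 : e ∈ Ε' <;>
      simp_all [N, maskedMatrix]
  have h2 : N * D' = G.maskedMatrix a Ψ Ε' := by
    ext r e
    rw [Matrix.mul_diagonal]
    by_cases h1 : r.1 ∈ Φ <;> by_cases h2 : r.1 ∈ Ψ <;> by_cases h3 : e ∈ Ε' <;>
      simp_all [N, maskedMatrix]
  rw [← h1, ← h2]
  refine Matrix.rank_mul_add_rank_mul_le D N D' ?_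
  rw [h1]
  ext r e
  rw [Matrix.mul_diagonal]
  by_cases h1 : r.1 ∈ Φ <;> by_cases h2 : e ∈ Ε <;> by_cases h3 : e ∈ Ε' <;>
    simp_all [maskedMatrix]

/-- The extended cycle basis matrix with indeterminate labels. -/
noncomputable def genericMatrix (G : PlaneGraph V E F) (K : Type*) [Field K] (Φ : Finset F)
    (Ε : Finset E) : Matrix (Φ × Fin 3) Ε (MvPolynomial E K) :=
  Matrix.of fun r e => (G.bd r.1 e : MvPolynomial E K) * MvPolynomial.X (e : E) ^ (r.2 : ℕ)

lemma genericMatrix_map (G : PlaneGraph V E F) (Φ : Finset F) (Ε : Finset E) (a : E → K) :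
    (G.genericMatrix K Φ Ε).map (MvPolynomial.eval a) = G.labelMatrix a Φ Ε := by
  ext r e
  simp [genericMatrix, labelMatrix]

lemma isAlgebraicVariety_rank_labelMatrix_lt (G : PlaneGraph V E F) (Φ : Finset F) (Ε : Finset E)
    (r : ℕ) : IsAlgebraicVariety {a : E → K | (G.labelMatrix a Φ Ε).rank < r} := by
  simpa only [genericMatrix_map] using isAlgebraicVariety_rank_lt (G.genericMatrix K Φ Ε) r

/-- Finitely many extended cycle basis matrices can be given maximal rank simultaneously. -/
lemma exists_rank_labelMatrix_ge_forall [Infinite K] (G : PlaneGraph V E F) {ι : Type*}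
    (s : Finset ι) (Φ : ι → Finset F) (Ε : ι → Finset E) (b : ι → E → K) :
    ∃ a : E → K, ∀ i ∈ s,
      (G.labelMatrix (b i) (Φ i) (Ε i)).rank ≤ (G.labelMatrix a (Φ i) (Ε i)).rank := by
  choose p hp hle using fun i =>
    (G.genericMatrix K (Φ i) (Ε i)).exists_eval_ne_zero_imp_rank_le (b i)
  have h : ∏ i ∈ s, p i ≠ 0 := Finset.prod_ne_zero_iff.2 fun i _ h0 => hp i (by simp [h0])
  obtain ⟨a, ha⟩ : ∃ a, MvPolynomial.eval a (∏ i ∈ s, p i) ≠ 0 := by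
    by_contra! h0
    exact h (MvPolynomial.funext fun x => by rw [h0, map_zero])
  rw [map_prod, Finset.prod_ne_zero_iff] at ha
  refine ⟨a, fun i hi => ?_⟩
  simpa only [genericMatrix_map] using hle i a (ha i hi)

end LabelRank
end PlaneGraph

/-! ### Laplace expansion along blocks of three rows -/

section Laplace

lemma Equiv.Perm.sign_eq_neg_one_pow_card_inversions {n : ℕ} (σ : Equiv.Perm (Fin n)) :
    (Equiv.Perm.sign σ : ℤ) =
      (-1) ^ (Finset.univ.filter (fun p : Fin n × Fin n => p.1 < p.2 ∧ σ p.2 < σ p.1)).card := by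
  rw [σ.sign_eq_prod_prod_Ioi, Finset.prod_sigma', Units.coe_prod]
  have h : ∀ x ∈ (Finset.univ : Finset (Fin n)).sigma Finset.Ioi,
      (((if σ x.1 < σ x.2 then 1 else -1 : ℤˣ)) : ℤ) =
        if σ x.2 < σ x.1 then -1 else 1 := by
    intro x hx
    have hne : σ x.1 ≠ σ x.2 := σ.injective.ne (by simpa using (Finset.mem_sigma.1 hx).2 : x.1 < x.2).ne
    rcases lt_or_gt_of_ne hne with h | h
    · simp [h, h.not_gt]
    · simp [h, h.not_gt]
  rw [Finset.prod_congr rfl h, Finset.prod_ite, Finset.prod_const_one, mul_one,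
    Finset.prod_const]
  congr 1
  refine Finset.card_bij (fun x _ => (x.1, x.2)) ?_ ?_ ?_
  · intro x hx
    simpa using hx
  · rintro ⟨a, b⟩ _ ⟨c, d⟩ _ h
    simpa using h
  · rintro ⟨a, b⟩ hab
    exact ⟨⟨a, b⟩, by simpa using hab, rfl⟩

variable {α ε : Type*} [LinearOrder α] [LinearOrder ε]

/-- The edges of the triples `φ`, in the order of the faces. -/
def tripleMap {C : Finset ε} (e : α × Fin 3 ≃ C) (φ : α → {A : Finset ε // A.card = 3})
    (hC : ∀ f, ∀ x ∈ (φ f).1, x ∈ C) (p : α × Fin 3) : α × Fin 3 :=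
  e.symm ⟨(φ p.1).1.orderEmbOfFin (φ p.1).2 p.2, hC _ _ (Finset.orderEmbOfFin_mem _ _ _)⟩

lemma tripleMap_injective {C : Finset ε} (e : α × Fin 3 ≃ C)
    (φ : α → {A : Finset ε // A.card = 3}) (hC : ∀ f, ∀ x ∈ (φ f).1, x ∈ C)
    (hd : ∀ f f', f ≠ f' → Disjoint (φ f).1 (φ f').1) :
    Function.Injective (tripleMap e φ hC) := by
  rintro ⟨f, t⟩ ⟨f', t'⟩ h
  have h1 : (φ f).1.orderEmbOfFin (φ f).2 t = (φ f').1.orderEmbOfFin (φ f').2 t' := by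
    simpa [tripleMap] using h
  have hff : f = f' := by
    by_contra hne
    exact Finset.disjoint_left.1 (hd f f' hne) (Finset.orderEmbOfFin_mem _ (φ f).2 t)
      (h1 ▸ Finset.orderEmbOfFin_mem _ (φ f').2 t')
  subst hff
  rw [((φ f).1.orderEmbOfFin (φ f).2).injective h1]

/-- The permutation of the columns given by disjoint triples. -/
noncomputable def triplePerm [Fintype α] {C : Finset ε} (e : α × Fin 3 ≃ C)
    (φ : α → {A : Finset ε // A.card = 3}) (hC : ∀ f, ∀ x ∈ (φ f).1, x ∈ C)
    (hd : ∀ f f', f ≠ f' → Disjoint (φ f).1 (φ f').1) : Equiv.Perm (α × Fin 3) :=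
  Equiv.ofBijective _ (Finite.injective_iff_bijective.1 (tripleMap_injective e φ hC hd))

lemma triplePerm_apply [Fintype α] {C : Finset ε} (e : α × Fin 3 ≃ C)
    (φ : α → {A : Finset ε // A.card = 3}) (hC : ∀ f, ∀ x ∈ (φ f).1, x ∈ C)
    (hd : ∀ f f', f ≠ f' → Disjoint (φ f).1 (φ f').1) (p : α × Fin 3) :
    (e (triplePerm e φ hC hd p) : ε) = (φ p.1).1.orderEmbOfFin (φ p.1).2 p.2 := by
  simp [triplePerm, tripleMap]

open scoped Classical in
-- The permutation is increasing within each face, so all its inversions come from pairs of distinct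
-- faces.
lemma sign_triplePerm [Fintype α] [Fintype ε] {C : Finset ε} (e : α × Fin 3 ≃ C)
    (he : ∀ p q, e p < e q ↔ toLex p < toLex q)
    (φ : α → {A : Finset ε // A.card = 3}) (hC : ∀ f, ∀ x ∈ (φ f).1, x ∈ C)
    (hd : ∀ f f', f ≠ f' → Disjoint (φ f).1 (φ f').1) :
    (Equiv.Perm.sign (triplePerm e φ hC hd) : ℤ) =
      (-1) ^ (Finset.univ.filter (fun p : (α × ε) × (α × ε) =>
        p.1.2 ∈ (φ p.1.1).1 ∧ p.2.2 ∈ (φ p.2.1).1 ∧ p.1.1 < p.2.1 ∧ p.2.2 < p.1.2)).card := by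
  set β := triplePerm e φ hC hd with hβ
  let o : α × Fin 3 ≃ Fin (Fintype.card (α × Fin 3)) :=
    toLex.trans (monoEquivOfFin (α ×ₗ Fin 3) (by simp [Lex])).symm.toEquiv
  have ho : ∀ p q, o p < o q ↔ toLex p < toLex q := fun p q => by simp [o]
  have hlt : ∀ p q, o (β q) < o (β p) ↔ (φ q.1).1.orderEmbOfFin (φ q.1).2 q.2 <
      (φ p.1).1.orderEmbOfFin (φ p.1).2 p.2 := by
    intro p q
    rw [ho, ← he, ← Subtype.coe_lt_coe, triplePerm_apply, triplePerm_apply]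
  rw [← Equiv.Perm.sign_permCongr o β, Equiv.Perm.sign_eq_neg_one_pow_card_inversions]
  congr 1
  refine Finset.card_bij (fun x _ =>
    (((o.symm x.1).1, (φ (o.symm x.1).1).1.orderEmbOfFin (φ (o.symm x.1).1).2 (o.symm x.1).2),
     ((o.symm x.2).1, (φ (o.symm x.2).1).1.orderEmbOfFin (φ (o.symm x.2).1).2 (o.symm x.2).2)))
    ?_ ?_ ?_
  · rintro ⟨x, y⟩ hxy
    obtain ⟨p, rfl⟩ := o.surjective x
    obtain ⟨q, rfl⟩ := o.surjective y
    replace hxy := (Finset.mem_filter.1 hxy).2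
    simp only [Equiv.permCongr_apply, Equiv.symm_apply_apply] at hxy
    rw [ho, hlt, Prod.Lex.toLex_lt_toLex] at hxy
    simp only [Finset.mem_filter, Finset.mem_univ, true_and, Equiv.symm_apply_apply]
    refine ⟨Finset.orderEmbOfFin_mem _ _ _, Finset.orderEmbOfFin_mem _ _ _, ?_, hxy.2⟩
    rcases hxy.1 with h | ⟨h1, h2⟩
    · exact h
    · obtain ⟨f, t⟩ := p
      obtain ⟨f', t'⟩ := q
      simp only at h1 h2
      subst h1
      exact absurd (((φ f).1.orderEmbOfFin (φ f).2).lt_iff_lt.1 hxy.2) h2.not_gt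
  · rintro ⟨x, y⟩ _ ⟨x', y'⟩ _ h
    have key : ∀ x x' : Fin (Fintype.card (α × Fin 3)),
        ((o.symm x).1, (φ (o.symm x).1).1.orderEmbOfFin (φ (o.symm x).1).2 (o.symm x).2) =
        ((o.symm x').1, (φ (o.symm x').1).1.orderEmbOfFin (φ (o.symm x').1).2 (o.symm x').2) →
        x = x' := by
      intro x x' hx
      obtain ⟨⟨f, t⟩, rfl⟩ := o.surjective x
      obtain ⟨⟨f', t'⟩, rfl⟩ := o.surjective x'
      simp only [Equiv.symm_apply_apply, Prod.mk.injEq] at hx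
      obtain ⟨rfl, hx⟩ := hx
      rw [((φ f).1.orderEmbOfFin (φ f).2).injective hx]
    rw [Prod.mk.injEq] at h
    exact Prod.ext (key _ _ h.1) (key _ _ h.2)
  · rintro ⟨⟨f, x⟩, ⟨f', x'⟩⟩ h
    simp only [Finset.mem_filter, Finset.mem_univ, true_and] at h
    obtain ⟨hx, hx', hff, hlt'⟩ := h
    have hr : ∀ f x, x ∈ (φ f).1 → ∃ t, (φ f).1.orderEmbOfFin (φ f).2 t = x := by
      intro f x hx
      have : x ∈ Set.range ((φ f).1.orderEmbOfFin (φ f).2) := by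
        rw [Finset.range_orderEmbOfFin]; exact hx
      exact this
    obtain ⟨t, rfl⟩ := hr f x hx
    obtain ⟨t', rfl⟩ := hr f' x' hx'
    refine ⟨(o (f, t), o (f', t')), ?_, by simp⟩
    refine Finset.mem_filter.2 ⟨Finset.mem_univ _, ?_⟩
    simp only [Equiv.permCongr_apply, Equiv.symm_apply_apply]
    rw [ho, hlt, Prod.Lex.toLex_lt_toLex]
    exact ⟨Or.inl hff, hlt'⟩

open scoped Classical in
/-- **Generalized Laplace expansion** along blocks of three rows. -/
lemma det_eq_sum_triples {R : Type*} [CommRing R] [Fintype α] [Fintype ε] {C : Finset ε} (e : α × Fin 3 ≃ C)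
    (he : ∀ p q, e p < e q ↔ toLex p < toLex q) (M : α → Fin 3 → ε → R) :
    (Matrix.of fun p q : α × Fin 3 => M p.1 p.2 (e q)).det =
      ∑ φ ∈ Finset.univ.filter (fun φ : α → {A : Finset ε // A.card = 3} =>
          (∀ f, ∀ x ∈ (φ f).1, x ∈ C) ∧ ∀ f f', f ≠ f' → Disjoint (φ f).1 (φ f').1),
        ((((-1) ^ (Finset.univ.filter (fun p : (α × ε) × (α × ε) =>
          p.1.2 ∈ (φ p.1.1).1 ∧ p.2.2 ∈ (φ p.2.1).1 ∧ p.1.1 < p.2.1 ∧ p.2.2 < p.1.2)).card : ℤ)) : R)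
        * ∏ f, (Matrix.of fun t j => M f t ((φ f).1.orderEmbOfFin (φ f).2 j)).det := by
  have hexp : ∀ φ : α → {A : Finset ε // A.card = 3},
      ∏ f, (Matrix.of fun t j => M f t ((φ f).1.orderEmbOfFin (φ f).2 j)).det =
        ∑ τ : α → Equiv.Perm (Fin 3), ∏ f, (((Equiv.Perm.sign (τ f) : ℤ) : R) *
          ∏ t, M f t ((φ f).1.orderEmbOfFin (φ f).2 (τ f t))) := by
    intro φ
    have h : ∀ f, (Matrix.of fun t j => M f t ((φ f).1.orderEmbOfFin (φ f).2 j)).det =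
        ∑ τ : Equiv.Perm (Fin 3), (((Equiv.Perm.sign τ : ℤ) : R) *
          ∏ t, M f t ((φ f).1.orderEmbOfFin (φ f).2 (τ t))) := by
      intro f
      rw [← Matrix.det_transpose, Matrix.det_apply']
      rfl
    simp only [h]
    rw [Finset.prod_univ_sum, Fintype.piFinset_univ]
  rw [← Matrix.det_transpose, Matrix.det_apply']
  simp only [hexp, Finset.mul_sum]
  rw [← Finset.sum_product', eq_comm]
  have hx : ∀ x ∈ (Finset.univ.filter (fun φ : α → {A : Finset ε // A.card = 3} =>
      (∀ f, ∀ x ∈ (φ f).1, x ∈ C) ∧ ∀ f f', f ≠ f' → Disjoint (φ f).1 (φ f').1)) ×ˢ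
      (Finset.univ : Finset (α → Equiv.Perm (Fin 3))),
      (∀ f, ∀ y ∈ (x.1 f).1, y ∈ C) ∧ ∀ f f', f ≠ f' → Disjoint (x.1 f).1 (x.1 f').1 := by
    intro x hx
    exact (Finset.mem_filter.1 (Finset.mem_product.1 hx).1).2
  have hap : ∀ φ hC hd (τ : α → Equiv.Perm (Fin 3)) (p : α × Fin 3),
      (e ((triplePerm e φ hC hd * Equiv.prodCongrRight τ) p) : ε) =
        (φ p.1).1.orderEmbOfFin (φ p.1).2 (τ p.1 p.2) := by
    intro φ hC hd τ p
    rw [Equiv.Perm.mul_apply, triplePerm_apply]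
    rfl
  -- Every permutation is uniquely a permutation within the blocks followed by a shuffle that is
  -- increasing on each block.
  refine Finset.sum_bij (fun x h => triplePerm e x.1 (hx x h).1 (hx x h).2 *
    Equiv.prodCongrRight x.2) ?_ ?_ ?_ ?_
  · intro x h
    exact Finset.mem_univ _
  · rintro ⟨φ, τ⟩ h ⟨φ', τ'⟩ h' heq
    have h1 : ∀ f t, (φ f).1.orderEmbOfFin (φ f).2 (τ f t) =
        (φ' f).1.orderEmbOfFin (φ' f).2 (τ' f t) := by
      intro f t
      rw [← hap φ (hx _ h).1 (hx _ h).2 τ (f, t), ← hap φ' (hx _ h').1 (hx _ h').2 τ' (f, t)]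
      rw [heq]
    have hφ : φ = φ' := by
      funext f
      apply Subtype.ext
      rw [← Finset.coe_inj, ← Finset.range_orderEmbOfFin _ (φ f).2,
        ← Finset.range_orderEmbOfFin _ (φ' f).2]
      rw [← (τ f).surjective.range_comp ((φ f).1.orderEmbOfFin (φ f).2),
        ← (τ' f).surjective.range_comp ((φ' f).1.orderEmbOfFin (φ' f).2)]
      congr 1
      funext t
      exact h1 f t
    subst hφ
    have hτ : τ = τ' := by
      funext f
      ext1 t
      exact ((φ f).1.orderEmbOfFin (φ f).2).injective (h1 f t)
    rw [hτ]
  · intro σ _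
    have hinj : ∀ f, Function.Injective (fun t => (e (σ (f, t)) : ε)) := by
      intro f t t' h
      have := σ.injective (e.injective (Subtype.ext h))
      simpa using this
    let φ : α → {A : Finset ε // A.card = 3} := fun f =>
      ⟨Finset.univ.image (fun t => (e (σ (f, t)) : ε)), by
        rw [Finset.card_image_of_injective _ (hinj f)]; simp⟩
    have hmem : ∀ f x, x ∈ (φ f).1 ↔ ∃ t, (e (σ (f, t)) : ε) = x := by
      intro f x; simp [φ]
    have hC : ∀ f, ∀ x ∈ (φ f).1, x ∈ C := by
      intro f x hx
      obtain ⟨t, rfl⟩ := (hmem f x).1 hx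
      exact (e (σ (f, t))).2
    have hd : ∀ f f', f ≠ f' → Disjoint (φ f).1 (φ f').1 := by
      intro f f' hne
      rw [Finset.disjoint_left]
      intro x hx hx'
      obtain ⟨t, ht⟩ := (hmem f x).1 hx
      obtain ⟨t', ht'⟩ := (hmem f' x).1 hx'
      have := σ.injective (e.injective (Subtype.ext (ht.trans ht'.symm)))
      exact hne (Prod.mk.inj this).1
    have hr : ∀ f t, ∃ j, (φ f).1.orderEmbOfFin (φ f).2 j = e (σ (f, t)) := by
      intro f t
      have : (e (σ (f, t)) : ε) ∈ Set.range ((φ f).1.orderEmbOfFin (φ f).2) := by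
        rw [Finset.range_orderEmbOfFin]; exact (hmem f _).2 ⟨t, rfl⟩
      exact this
    choose τ hτ using hr
    have hτinj : ∀ f, Function.Injective (τ f) := by
      intro f t t' h
      apply hinj f
      simp only
      rw [← hτ, ← hτ, h]
    refine ⟨(φ, fun f => Equiv.ofBijective (τ f) (Finite.injective_iff_bijective.1 (hτinj f))),
      Finset.mem_product.2 ⟨Finset.mem_filter.2 ⟨Finset.mem_univ _, hC, hd⟩, Finset.mem_univ _⟩,
      ?_⟩
    ext1 ⟨f, t⟩
    apply e.injective
    apply Subtype.ext
    rw [hap]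
    exact hτ f t
  · rintro ⟨φ, τ⟩ h
    have hs := sign_triplePerm e he φ (hx _ h).1 (hx _ h).2
    rw [Equiv.Perm.sign_mul, Equiv.Perm.sign_prodCongrRight, Units.val_mul, hs,
      Finset.prod_mul_distrib, Fintype.prod_prod_type]
    push_cast
    rw [mul_assoc]
    congr 2
    refine Finset.prod_congr rfl fun f _ => Finset.prod_congr rfl fun t _ => ?_
    exact congrArg (M f t) (hap φ (hx _ h).1 (hx _ h).2 τ (f, t)).symm

end Laplace
namespace PlaneGraph

/-! ### Edge-injective polynomials as maximal minors -/

section Loci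

variable {V E F : Type*} [Fintype V] [Fintype E] [Fintype F] {K : Type*} [Field K]

lemma rank_labelMatrix_mono_edges (G : PlaneGraph V E F) (a : E → K) (Φ : Finset F)
    {Ε Ε' : Finset E} (h : Ε ⊆ Ε') :
    (G.labelMatrix a Φ Ε).rank ≤ (G.labelMatrix a Φ Ε').rank :=
  Matrix.rank_submatrix_le (G.labelMatrix a Φ Ε') id (fun e : Ε => (⟨e, h e.2⟩ : Ε'))

/-- The rows are independent if and only if some square submatrix with all rows is regular. -/
lemma rank_labelMatrix_lt_iff (G : PlaneGraph V E F) (a : E → K) (Φ : Finset F) (Ε : Finset E) :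
    (G.labelMatrix a Φ Ε).rank < 3 * Φ.card ↔
      ∀ C ∈ Ε.powersetCard (3 * Φ.card), (G.labelMatrix a Φ C).rank < 3 * Φ.card := by
  classical
  constructor
  · intro h C hC
    exact (G.rank_labelMatrix_mono_edges a Φ (Finset.mem_powersetCard.1 hC).1).trans_lt h
  · intro h
    by_contra hr
    have hr' := le_antisymm (G.rank_labelMatrix_le_faces a Φ Ε) (not_lt.1 hr)
    obtain ⟨c, hc, hli⟩ := (G.labelMatrix a Φ Ε).exists_linearIndependent_cols
    let C : Finset E := Finset.univ.image (fun i => (c i : E))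
    have hcC : ∀ i, (c i : E) ∈ C := fun i => Finset.mem_image_of_mem _ (Finset.mem_univ i)
    have hC : C ∈ Ε.powersetCard (3 * Φ.card) := by
      refine Finset.mem_powersetCard.2 ⟨?_, ?_⟩
      · intro x hx
        obtain ⟨i, -, rfl⟩ := Finset.mem_image.1 hx
        exact (c i).2
      · refine (Finset.card_image_of_injective _ (Subtype.val_injective.comp hc)).trans ?_
        rw [Finset.card_univ, Fintype.card_fin, hr']
    let L := (G.labelMatrix a Φ C).submatrix id (fun i => (⟨c i, hcC i⟩ : C))
    have hL : L.transpose.rank = 3 * Φ.card := by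
      have : LinearIndependent K L.transpose.row := hli
      rw [this.rank_matrix, Fintype.card_fin, hr']
    rw [Matrix.rank_transpose] at hL
    exact absurd (h C hC) (not_lt.2 (hL.symm.le.trans (Matrix.rank_submatrix_le _ _ _)))

lemma _root_.Matrix.det_eq_zero_iff_rank_lt {n : Type*} [Fintype n] [DecidableEq n]
    (A : Matrix n n K) : A.det = 0 ↔ A.rank < Fintype.card n := by
  constructor
  · intro h
    refine lt_of_le_of_ne (Matrix.rank_le_card_width A) fun hr => ?_
    have htop : LinearMap.range A.mulVecLin = ⊤ := by
      apply Submodule.eq_top_of_finrank_eq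
      rw [Module.finrank_fintype_fun_eq_card]
      exact hr
    have := (Matrix.isUnit_iff_isUnit_det A).1
      (Matrix.mulVec_surjective_iff_isUnit.1 (LinearMap.range_eq_top.1 htop))
    exact this.ne_zero h
  · intro h
    by_contra h0
    exact h.ne (Matrix.rank_of_det_ne_zero h0)

/-- By Laplace expansion the polynomial evaluates to the minor with columns `C`. -/
lemma eval_edgeInjectivePoly_eq_zero_iff [LinearOrder E] [LinearOrder F] {G : PlaneGraph V E F}
    (H : G.Minor) {C : Finset E} (hC : C.card = 3 * H.faces.card) (a : E → K) :
    MvPolynomial.eval a (H.edgeInjectivePoly K C) = 0 ↔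
      (G.labelMatrix a H.faces C).rank < 3 * H.faces.card := by
  classical
  have h1 : Fintype.card (H.faces ×ₗ Fin 3) = 3 * H.faces.card := by simp [Lex, mul_comm]
  let e' : H.faces ×ₗ Fin 3 ≃o C :=
    (monoEquivOfFin (H.faces ×ₗ Fin 3) h1).symm.trans (C.orderIsoOfFin hC)
  let e : H.faces × Fin 3 ≃ C := toLex.trans e'.toEquiv
  have he : ∀ p q, e p < e q ↔ toLex p < toLex q := fun p q => by simp [e]
  let M : H.faces → Fin 3 → E → K := fun f t x => (G.bd f x : K) * a x ^ (t : ℕ)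
  have hdet := det_eq_sum_triples e he M
  have hface : ∀ (f : H.faces) (A : {A : Finset E // A.card = 3}),
      MvPolynomial.eval a (Minor.faceMatrix K G f A).det =
        (Matrix.of fun t j => M f t (A.1.orderEmbOfFin A.2 j)).det := by
    intro f A
    rw [RingHom.map_det]
    congr 1
    ext t j
    simp [Minor.faceMatrix, M]
  have heval : MvPolynomial.eval a (H.edgeInjectivePoly K C) =
      (Matrix.of fun p q : H.faces × Fin 3 => M p.1 p.2 (e q)).det := by
    rw [Minor.edgeInjectivePoly, map_sum]
    refine Eq.trans ?_ ((Finset.sum_subset (s₁ := Finset.univ.filter (H.IsEdgeInjective C))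
      ?_ ?_).trans (hdet.symm.trans (by congr!)))
    · refine Finset.sum_congr (by congr) fun φ _ => ?_
      rw [map_mul, map_prod, map_intCast]
      congr 1
      exact Finset.prod_congr rfl fun f _ => hface f (φ f)
    · intro φ hφ
      simp only [Finset.mem_filter, Finset.mem_univ, true_and] at hφ ⊢
      exact ⟨fun f x hx => (hφ.1 f x hx).1, hφ.2⟩
    · intro φ hφ hφ'
      simp only [Finset.mem_filter, Finset.mem_univ, true_and] at hφ hφ'
      -- A triple with an edge off the boundary of its face contributes a zero column.
      obtain ⟨f, x, hx, hb⟩ : ∃ f, ∃ x ∈ (φ f).1, G.bd f x = 0 := by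
        by_contra! h0
        exact hφ' ⟨fun f x hx => ⟨hφ.1 f x hx, h0 f x hx⟩, hφ.2⟩
      have hxr : x ∈ Set.range ((φ f).1.orderEmbOfFin (φ f).2) := by
        rw [Finset.range_orderEmbOfFin]; exact hx
      obtain ⟨j, rfl⟩ := hxr
      rw [Finset.prod_eq_zero (Finset.mem_univ f), mul_zero]
      exact Matrix.det_eq_zero_of_column_eq_zero j fun t => by simp [M, hb]
  have hsub : (Matrix.of fun p q : H.faces × Fin 3 => M p.1 p.2 (e q)) =
      (G.labelMatrix a H.faces C).submatrix (Equiv.refl _) e := rfl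
  rw [heval, Matrix.det_eq_zero_iff_rank_lt, hsub, Matrix.rank_submatrix]
  simp [mul_comm]

end Loci

/-! ### Rank along a contraction sequence -/

namespace IsContractionSeq

variable {V E F : Type*} [Fintype V] [Fintype E] [Fintype F] {K : Type*} [Field K]
  {G : PlaneGraph V E F} {k : ℕ} {S Φ : ℕ → Finset F}

open scoped Classical in
/-- If the set of all remaining faces is contractible, it can be contracted as well. -/
lemma extend (h : G.IsContractionSeq k S Φ) (hne : (Φ k).Nonempty)
    (hc : (G.edgesAt (Φ k) (Φ k)).card ≤ 3 * (Φ k).card) :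
    G.IsContractionSeq (k + 1) (Function.update S k (Φ k)) (Function.update Φ (k + 1) ∅) := by
  have hΦ : ∀ i ≤ k, Function.update Φ (k + 1) ∅ i = Φ i := fun i hi =>
    Function.update_of_ne (by omega) _ _
  have hS : ∀ i < k, Function.update S k (Φ k) i = S i := fun i hi =>
    Function.update_of_ne (by omega) _ _
  constructor
  · rw [hΦ 0 (by omega), h.zero]
  · intro i hi
    rcases Nat.lt_succ_iff_lt_or_eq.1 hi with h1 | rfl
    · rw [hΦ (i + 1) h1, hΦ i h1.le, hS i h1, h.succ i h1]
    · simp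
  · intro i hi
    rcases Nat.lt_succ_iff_lt_or_eq.1 hi with h1 | rfl
    · rw [hΦ i h1.le, hS i h1]
      exact h.isMin i h1
    · rw [hΦ i le_rfl, Function.update_self]
      exact ⟨subset_rfl, hne, hc, h.last⟩
  · intro i hi T T' hT hT' hTT
    rcases Nat.lt_or_eq_of_le hi with h1 | rfl
    · rw [hΦ i (by omega)] at hT hT' ⊢
      exact h.disj i (by omega) T T' hT hT' hTT
    · have h2 := hT.1
      rw [Function.update_self, Finset.subset_empty] at h2
      exact absurd h2 hT.2.1.ne_empty
  · intro T hT hTne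
    rw [Function.update_self] at hT
    exact absurd hT (Finset.not_ssubset_empty T)

/-- The edges on a set of faces that was contracted are the only nonzero columns. -/
lemma rank_labelMatrix_edgesAt (a : E → K) (Ψ X : Finset F) :
    (G.labelMatrix a X (G.edgesAt Ψ X)).rank = (G.labelMatrix a X (G.edgesOf Ψ)).rank := by
  refine G.rank_labelMatrix_congr a fun f e hfe => ?_
  constructor
  · rintro ⟨h1, h2⟩
    exact ⟨h1, mem_edgesOf.2 (mem_edgesAt.1 h2).1⟩
  · rintro ⟨h1, h2⟩
    exact ⟨h1, mem_edgesAt.2 ⟨mem_edgesOf.1 h2, f, h1, hfe⟩⟩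

/-- Columns removed before stage `l` do not raise the rank of these rows above the expected one:
either there are no more rows than that, or the single face has no entries in those columns. -/
lemma rank_edgesOf_le_card (h : G.IsContractionSeq k S Φ) (hG : G.ShareAtMostOneEdge) (a : E → K)
    {i l : ℕ} (hil : i ≤ l) (hl : l < k) :
    (G.labelMatrix a (S l) (G.edgesOf (Φ i))).rank ≤ (G.edgesAt (Φ l) (S l)).card := by
  rcases h.card_eq_or_singleton hG hl with h1 | ⟨⟨f, hf⟩, h1⟩
  · rw [h1]
    exact G.rank_labelMatrix_le_faces _ _ _
  · rw [← rank_labelMatrix_edgesAt]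
    refine (G.rank_labelMatrix_le_edges _ _ _).trans (le_of_eq ?_)
    rw [hf, h.edgesAt_eq_of_card_le_two hG hl hf (by rw [← hf]; omega) hil]

/-- With fewer than three edges per face, the last graph is itself minimal contractible, and
`extend` reduces to the previous lemma. -/
lemma rank_last_edgesOf_le (h : G.IsContractionSeq k S Φ) (hG : G.ShareAtMostOneEdge) (a : E → K)
    {i : ℕ} (hi : i ≤ k) :
    (G.labelMatrix a (Φ k) (G.edgesOf (Φ i))).rank ≤
      min (G.edgesAt (Φ k) (Φ k)).card (3 * (Φ k).card) := by
  refine le_min ?_ (G.rank_labelMatrix_le_faces _ _ _)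
  by_cases hc : (G.edgesAt (Φ k) (Φ k)).card < 3 * (Φ k).card
  · have hne : (Φ k).Nonempty := by
      by_contra h0
      rw [Finset.not_nonempty_iff_eq_empty] at h0
      simp [h0] at hc
    have h1 := (h.extend hne hc.le).rank_edgesOf_le_card hG a hi (Nat.lt_succ_self k)
    rwa [Function.update_self, Function.update_of_ne (by omega),
      Function.update_of_ne (by omega)] at h1
  · exact (G.rank_labelMatrix_le_faces _ _ _).trans (not_lt.1 hc)

lemma rank_remaining_edgesOf_le (h : G.IsContractionSeq k S Φ) (hG : G.ShareAtMostOneEdge)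
    (a : E → K) {i j : ℕ} (hij : i ≤ j) (hj : j ≤ k) :
    (G.labelMatrix a (Φ j) (G.edgesOf (Φ i))).rank ≤
      ∑ l ∈ Finset.Ico j k, (G.edgesAt (Φ l) (S l)).card +
        min (G.edgesAt (Φ k) (Φ k)).card (3 * (Φ k).card) := by
  classical
  induction hj using Nat.decreasingInduction with
  | self => simpa using h.rank_last_edgesOf_le hG a hij
  | of_succ j hj ih =>
    have h1 := ih (by omega)
    have h2 : Φ j = S j ∪ Φ (j + 1) := by
      rw [h.succ j hj, Finset.union_sdiff_of_subset (h.isMin j hj).1]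
    have hd : Disjoint (S j) (Φ (j + 1)) := by
      rw [h.succ j hj]; exact Finset.disjoint_sdiff
    have h3 := G.rank_labelMatrix_union_faces_le a hd (G.edgesOf (Φ i))
    rw [← h2] at h3
    have h4 := h.rank_edgesOf_le_card hG a hij hj
    rw [Finset.sum_eq_sum_Ico_succ_bot hj]
    omega

/-- Split by columns: in the surviving ones the rows of `S i` vanish. -/
lemma rank_le_add_rank_succ (h : G.IsContractionSeq k S Φ) (a : E → K) {i : ℕ} (hi : i < k) :
    (G.labelMatrix a (Φ i) (G.edgesOf (Φ i))).rank ≤ (G.edgesAt (Φ i) (S i)).card +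
      (G.labelMatrix a (Φ (i + 1)) (G.edgesOf (Φ (i + 1)))).rank := by
  classical
  have h1 : G.edgesOf (Φ i) = G.edgesAt (Φ i) (S i) ∪ G.edgesOf (Φ (i + 1)) := by
    ext e
    rw [Finset.mem_union, h.succ i hi, mem_edgesOf_sdiff]
    have : e ∈ G.edgesAt (Φ i) (S i) → e ∈ G.edgesOf (Φ i) := fun he =>
      mem_edgesOf.2 (mem_edgesAt.1 he).1
    tauto
  have hd : Disjoint (G.edgesAt (Φ i) (S i)) (G.edgesOf (Φ (i + 1))) := by
    rw [Finset.disjoint_left]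
    intro e he he'
    rw [h.succ i hi, mem_edgesOf_sdiff] at he'
    exact he'.2 he
  have h2 := G.rank_labelMatrix_union_edges_le a (Φ i) hd
  rw [← h1] at h2
  have h3 : (G.labelMatrix a (Φ i) (G.edgesOf (Φ (i + 1)))).rank =
      (G.labelMatrix a (Φ (i + 1)) (G.edgesOf (Φ (i + 1)))).rank := by
    refine G.rank_labelMatrix_congr a fun f e hfe => ?_
    constructor
    · rintro ⟨-, h2⟩
      refine ⟨?_, h2⟩
      by_contra hf
      exact hfe (mem_edgesOf.1 h2 f hf)
    · rintro ⟨h1, h2⟩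
      exact ⟨h.subset_of_le (Nat.le_succ i) hi h1, h2⟩
  have h4 := G.rank_labelMatrix_le_edges a (Φ i) (G.edgesAt (Φ i) (S i))
  omega

lemma add_rank_succ_le (h : G.IsContractionSeq k S Φ) (a : E → K) {i : ℕ} (hi : i < k) :
    (G.labelMatrix a (S i) (G.edgesAt (Φ i) (S i))).rank +
      (G.labelMatrix a (Φ (i + 1)) (G.edgesOf (Φ (i + 1)))).rank ≤
      (G.labelMatrix a (Φ i) (G.edgesOf (Φ i))).rank := by
  classical
  have h1 := G.add_rank_labelMatrix_le a (Φ := S i) (Ψ := Φ (i + 1))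
    (Ε := G.edgesAt (Φ i) (S i)) (Ε' := G.edgesOf (Φ (i + 1)))
    (by rw [h.succ i hi]; exact Finset.disjoint_sdiff) ?_
  · refine h1.trans (le_of_eq ?_)
    refine G.rank_labelMatrix_congr a fun f e hfe => ?_
    have h2 : f ∈ S i ∪ Φ (i + 1) ↔ f ∈ Φ i := by
      rw [h.succ i hi, Finset.union_sdiff_of_subset (h.isMin i hi).1]
    rw [h2, Finset.mem_union, h.succ i hi, mem_edgesOf_sdiff]
    have : e ∈ G.edgesAt (Φ i) (S i) → e ∈ G.edgesOf (Φ i) := fun he =>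
      mem_edgesOf.2 (mem_edgesAt.1 he).1
    tauto
  · intro f hf e he
    rw [h.succ i hi] at he
    exact mem_edgesOf.1 he f fun h0 => (Finset.mem_sdiff.1 h0).2 hf

/-- The rank of the whole matrix is smaller than expected if and only if the rank of one of the
diagonal blocks is. -/
lemma rank_lt_iff (h : G.IsContractionSeq k S Φ) (hG : G.ShareAtMostOneEdge) (a : E → K) :
    (G.labelMatrix a (Φ 0) (G.edgesOf (Φ 0))).rank <
        ∑ l ∈ Finset.Ico 0 k, (G.edgesAt (Φ l) (S l)).card +
          min (G.edgesAt (Φ k) (Φ k)).card (3 * (Φ k).card) ↔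
      (∃ i < k, (G.labelMatrix a (S i) (G.edgesAt (Φ i) (S i))).rank <
          (G.edgesAt (Φ i) (S i)).card) ∨
        (G.labelMatrix a (Φ k) (G.edgesOf (Φ k))).rank <
          min (G.edgesAt (Φ k) (Φ k)).card (3 * (Φ k).card) := by
  classical
  have hle : ∀ i ≤ k, (G.labelMatrix a (Φ 0) (G.edgesOf (Φ 0))).rank ≤
      ∑ l ∈ Finset.Ico 0 i, (G.edgesAt (Φ l) (S l)).card +
        (G.labelMatrix a (Φ i) (G.edgesOf (Φ i))).rank := by
    intro i
    induction i with
    | zero => intro _; simp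
    | succ i ih =>
      intro hi
      have h1 := ih (by omega)
      have h2 := h.rank_le_add_rank_succ a hi
      rw [Finset.sum_Ico_succ_top (Nat.zero_le i)]
      omega
  constructor
  · intro hlt
    by_contra! h0
    obtain ⟨h1, h2⟩ := h0
    refine absurd hlt (not_lt.2 ?_)
    have key : ∀ i ≤ k, ∑ l ∈ Finset.Ico 0 i, (G.edgesAt (Φ l) (S l)).card +
        (G.labelMatrix a (Φ i) (G.edgesOf (Φ i))).rank ≤
        (G.labelMatrix a (Φ 0) (G.edgesOf (Φ 0))).rank := by
      intro i
      induction i with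
      | zero => intro _; simp
      | succ i ih =>
        intro hi
        have h3 := ih (by omega)
        have h4 := h.add_rank_succ_le a hi
        have h5 := h1 i hi
        rw [Finset.sum_Ico_succ_top (Nat.zero_le i)]
        omega
    have := key k le_rfl
    omega
  · rintro (⟨i, hi, hlt⟩ | hlt)
    -- Stages before `i` are split off by columns. Stage `i` is split by rows, since the later rows
    -- do not exceed their expected rank even with the columns of `S i`; so its deficit persists.
    · have h1 := hle i hi.le
      have h2 : Φ i = S i ∪ Φ (i + 1) := by
        rw [h.succ i hi, Finset.union_sdiff_of_subset (h.isMin i hi).1]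
      have hd : Disjoint (S i) (Φ (i + 1)) := by
        rw [h.succ i hi]; exact Finset.disjoint_sdiff
      have h3 := G.rank_labelMatrix_union_faces_le a hd (G.edgesOf (Φ i))
      rw [← h2, ← rank_labelMatrix_edgesAt a (Φ i) (S i)] at h3
      have h4 := h.rank_remaining_edgesOf_le hG a (Nat.le_add_right i 1) hi
      rw [← Finset.sum_Ico_consecutive _ (Nat.zero_le i) hi.le,
        Finset.sum_eq_sum_Ico_succ_bot hi]
      omega
    · have h1 := hle k le_rfl
      omega

lemma exists_rank_ge [CharZero K] (h : G.IsContractionSeq k S Φ) (hG : G.ShareAtMostOneEdge)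
    {i : ℕ} (hi : i < k) : ∃ b : E → K, (G.edgesAt (Φ i) (S i)).card ≤
      (G.labelMatrix b (S i) (G.edgesAt (Φ i) (S i))).rank := by
  classical
  obtain ⟨b, hb⟩ := exists_rank_labelMatrix_ge (K := K) hG (Φ := S i)
    (Ε := G.edgesAt (Φ i) (S i)) (fun e he => (mem_edgesAt.1 he).2) fun T hT hTne =>
      ((h.isMin i hi).2.2.2 T hT hTne).trans_le (Finset.card_le_card fun e he =>
        Finset.mem_filter.2 ⟨G.edgesAt_mono _ hT.subset he, (mem_edgesAt.1 he).2⟩)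
  exact ⟨b, by rwa [min_eq_left (h.isMin i hi).2.2.1] at hb⟩

lemma exists_rank_last_ge [CharZero K] (h : G.IsContractionSeq k S Φ)
    (hG : G.ShareAtMostOneEdge) : ∃ b : E → K,
      min (G.edgesAt (Φ k) (Φ k)).card (3 * (Φ k).card) ≤
        (G.labelMatrix b (Φ k) (G.edgesOf (Φ k))).rank := by
  classical
  obtain ⟨b, hb⟩ := exists_rank_labelMatrix_ge (K := K) hG (Φ := Φ k)
    (Ε := G.edgesAt (Φ k) (Φ k)) (fun e he => (mem_edgesAt.1 he).2) fun T hT hTne =>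
      (h.last T hT hTne).trans_le (Finset.card_le_card fun e he =>
        Finset.mem_filter.2 ⟨G.edgesAt_mono _ hT.subset he, (mem_edgesAt.1 he).2⟩)
  exact ⟨b, by rwa [rank_labelMatrix_edgesAt] at hb⟩

/-- The blocks can be given their expected ranks simultaneously. -/
lemma exists_rank_whole_ge [CharZero K] (h : G.IsContractionSeq k S Φ)
    (hG : G.ShareAtMostOneEdge) : ∃ b : E → K,
      ∑ l ∈ Finset.Ico 0 k, (G.edgesAt (Φ l) (S l)).card +
        min (G.edgesAt (Φ k) (Φ k)).card (3 * (Φ k).card) ≤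
        (G.labelMatrix b (Φ 0) (G.edgesOf (Φ 0))).rank := by
  classical
  obtain ⟨c, hc⟩ := h.exists_rank_last_ge (K := K) hG
  choose! b hb using fun i (hi : i < k) => h.exists_rank_ge (K := K) hG hi
  obtain ⟨a, ha⟩ := G.exists_rank_labelMatrix_ge_forall (Finset.range (k + 1))
    (fun i => if i < k then S i else Φ k)
    (fun i => if i < k then G.edgesAt (Φ i) (S i) else G.edgesOf (Φ k))
    (fun i => if i < k then b i else c)
  refine ⟨a, ?_⟩
  by_contra hlt
  rw [not_le, h.rank_lt_iff hG] at hlt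
  rcases hlt with ⟨i, hi, hlt⟩ | hlt
  · have h1 := ha i (Finset.mem_range.2 (by omega))
    rw [if_pos hi, if_pos hi, if_pos hi] at h1
    exact absurd ((hb i hi).trans h1) (not_le.2 hlt)
  · have h1 := ha k (Finset.mem_range.2 (by omega))
    rw [if_neg (lt_irrefl k), if_neg (lt_irrefl k), if_neg (lt_irrefl k)] at h1
    exact absurd (hc.trans h1) (not_le.2 hlt)

end IsContractionSeq
end PlaneGraph
namespace PlaneGraph

/-! ### From minors to face sets; faces with one or two edges -/

section Minors

variable {V E F : Type*} [Fintype V] [Fintype E] [Fintype F] {K : Type*} [Field K]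
  {G : PlaneGraph V E F}

/-- An upper bound that is attained is the maximal rank. -/
lemma Minor.inSpecialPosition_iff (H : G.Minor) {r : ℕ} (hle : ∀ a : E → K, (H.Mext a).rank ≤ r)
    (hge : ∃ b : E → K, r ≤ (H.Mext b).rank) (a : E → K) :
    H.InSpecialPosition a ↔ (H.Mext a).rank < r := by
  constructor
  · rintro ⟨b, hb⟩
    exact hb.trans_le (hle b)
  · intro h
    obtain ⟨b, hb⟩ := hge
    exact ⟨b, h.trans_le hb⟩

lemma Minor.edgesOn_eq {H : G.Minor} (hH : H.edges = G.edgesOf H.faces) (T : Finset F) :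
    H.edgesOn T = G.edgesAt H.faces T := by
  simp only [edgesOn, edgesAt, hH]

lemma Minor.edges_contract {H : G.Minor} (hH : H.edges = G.edgesOf H.faces) (T : Finset F) :
    (H.contract T).edges = G.edgesOf (H.contract T).faces := by
  classical
  ext e
  simp only [contract]
  rw [mem_edgesOf_sdiff, ← hH, ← edgesOn_eq hH]
  simp

lemma edges_contractSeq (G : PlaneGraph V E F) (S : ℕ → Finset F) (i : ℕ) :
    (G.whole.contractSeq S i).edges = G.edgesOf (G.whole.contractSeq S i).faces := by
  induction i with
  | zero =>
    ext e
    simp [Minor.contractSeq, whole, mem_edgesOf]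
  | succ i ih => exact Minor.edges_contract ih (S i)

lemma Minor.isMinimalContractible_iff {H : G.Minor} (hH : H.edges = G.edgesOf H.faces)
    (T : Finset F) : H.IsMinimalContractible T ↔ G.IsMinContractible H.faces T := by
  simp only [IsMinimalContractible, IsContractible, IsMinContractible, edgesOn_eq hH]
  constructor
  · rintro ⟨⟨h1, h2, h3⟩, h4⟩
    exact ⟨h1, h2, h3, fun X hX hne => not_le.1 fun h => h4 X hX ⟨hX.subset.trans h1, hne, h⟩⟩
  · rintro ⟨h1, h2, h3, h4⟩
    exact ⟨⟨h1, h2, h3⟩, fun X hX h => absurd h.2.2 (not_le.2 (h4 X hX h.2.1))⟩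

lemma isContractionSeq_faces (k : ℕ) (S : ℕ → Finset F) (G' : ℕ → G.Minor)
    (hG' : G' = G.whole.contractSeq S) (hmin : ∀ i < k, (G' i).IsMinimalContractible (S i))
    (hdisj : ∀ i ≤ k, ∀ T T' : Finset F, (G' i).IsMinimalContractible T →
      (G' i).IsMinimalContractible T' → T ≠ T' →
        Disjoint ((G' i).edgesOn T) ((G' i).edgesOn T'))
    (hlast : ∀ T, T ⊂ (G' k).faces → ¬ (G' k).IsContractible T) :
    G.IsContractionSeq k S (fun i => (G' i).faces) := by
  subst hG'
  have hE := G.edges_contractSeq S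
  refine ⟨rfl, fun i _ => rfl, fun i hi => (Minor.isMinimalContractible_iff (hE i) _).1 (hmin i hi),
    fun i hi T T' hT hT' hne => ?_, fun T hT hne => not_le.1 fun h => hlast T hT ?_⟩
  · have := hdisj i hi T T' ((Minor.isMinimalContractible_iff (hE i) _).2 hT)
      ((Minor.isMinimalContractible_iff (hE i) _).2 hT') hne
    rwa [Minor.edgesOn_eq (hE i), Minor.edgesOn_eq (hE i)] at this
  · exact ⟨hT.subset, hne, by rwa [Minor.edgesOn_eq (hE k)]⟩

lemma rank_labelMatrix_singleton_pos (a : E → K) [CharZero K] {f : F} {j : E} {Ε : Finset E}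
    (hj : j ∈ Ε) (hfj : G.bd f j ≠ 0) : 1 ≤ (G.labelMatrix a {f} Ε).rank := by
  let r : Fin 1 → ({f} : Finset F) × Fin 3 := fun _ => (⟨f, by simp⟩, 0)
  let c : Fin 1 → Ε := fun _ => ⟨j, hj⟩
  refine le_trans (le_of_eq ?_) (Matrix.rank_submatrix_le (G.labelMatrix a {f} Ε) r c)
  rw [Matrix.rank_of_det_ne_zero, Fintype.card_fin]
  simpa [Matrix.det_fin_one, labelMatrix, r, c] using hfj

lemma rank_labelMatrix_singleton_lt_two_iff [CharZero K] (a : E → K) {f : F} {j j' : E}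
    (hfj : G.bd f j ≠ 0) (hfj' : G.bd f j' ≠ 0) {Ε : Finset E} (hΕ : ∀ e, e ∈ Ε ↔ e = j ∨ e = j') :
    (G.labelMatrix a {f} Ε).rank < 2 ↔ a j = a j' := by
  constructor
  · intro h
    by_contra hne
    -- Powers 0 and 1 of the labels: a 2 × 2 Vandermonde determinant up to sign.
    let r : Fin 2 → ({f} : Finset F) × Fin 3 := fun t => (⟨f, by simp⟩, t.castSucc)
    let c : Fin 2 → Ε := ![⟨j, (hΕ j).2 (Or.inl rfl)⟩, ⟨j', (hΕ j').2 (Or.inr rfl)⟩]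
    refine absurd (le_trans (le_of_eq ?_)
      (Matrix.rank_submatrix_le (G.labelMatrix a {f} Ε) r c)) (not_le.2 h)
    rw [Matrix.rank_of_det_ne_zero, Fintype.card_fin]
    have h1 : (G.bd f j : K) * G.bd f j' * (a j' - a j) ≠ 0 :=
      mul_ne_zero (mul_ne_zero (by exact_mod_cast hfj) (by exact_mod_cast hfj'))
        (sub_ne_zero.2 (Ne.symm hne))
    convert h1 using 1
    simp [Matrix.det_fin_two, labelMatrix, r, c]
    ring
  · intro h
    have h1 : G.labelMatrix a {f} Ε =
        Matrix.vecMulVec (fun r : ({f} : Finset F) × Fin 3 => a j ^ (r.2 : ℕ)) (fun e : Ε => (G.bd f e : K)) := by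
      ext r e
      have hr : (r.1 : F) = f := Finset.mem_singleton.1 r.1.2
      have he : a e = a j := by
        rcases (hΕ e).1 e.2 with h0 | h0
        · rw [h0]
        · rw [h0, h]
      simp [labelMatrix, Matrix.vecMulVec_apply, hr, he, mul_comm]
    rw [h1]
    exact (Matrix.rank_vecMulVec_le _ _).trans_lt one_lt_two

end Minors

end PlaneGraph

/-! ### The main theorem -/

theorem mainTheorem6 {K : Type*} [Field K] [CharZero K]
    {V E F : Type*} [Fintype V] [Fintype E] [Fintype F] [LinearOrder E] [LinearOrder F]
    (G : PlaneGraph V E F) (hshare : G.ShareAtMostOneEdge)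
    (k : ℕ) (S : ℕ → Finset F) (G' : ℕ → G.Minor) (hG' : G' = G.whole.contractSeq S)
    (hmin : ∀ i < k, (G' i).IsMinimalContractible (S i))
    (hdisj : ∀ i ≤ k, ∀ T T' : Finset F, (G' i).IsMinimalContractible T →
      (G' i).IsMinimalContractible T' → T ≠ T' →
        Disjoint ((G' i).edgesOn T) ((G' i).edgesOn T'))
    (hlast : ∀ T, T ⊂ (G' k).faces → ¬ (G' k).IsContractible T) :
    -- special position for the contracted subgraphs, and the resulting varieties
    (∀ i < k,
      (∀ a : E → K, ((G' i).sub (S i)).InSpecialPosition a ↔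
        (((G' i).sub (S i)).Mext a).rank < ((G' i).sub (S i)).edges.card) ∧
      IsAlgebraicVariety (((G' i).sub (S i)).specialLocus K)) ∧
    -- special position for the last graph
    (∀ a : E → K, (G' k).InSpecialPosition a ↔
      ((G' k).Mext a).rank < min ((G' k).edgesOn (G' k).faces).card (3 * (G' k).faces.card)) ∧
    IsAlgebraicVariety ((G' k).specialLocus K) ∧
    -- special position for the whole graph
    G.whole.specialLocus K =
      (⋃ i ∈ Set.Iio k, ((G' i).sub (S i)).specialLocus K) ∪ (G' k).specialLocus K ∧
    IsAlgebraicVariety (G.whole.specialLocus K) ∧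
    -- the explicit polynomials for the contracted subgraphs
    (∀ i < k,
      (((((G' i).sub (S i)).edges.card : ℤ) - 3 * (S i).card = -2 ∧
          (∃ j, ((G' i).sub (S i)).edges = {j}) ∧
          ((G' i).sub (S i)).specialLocus K = ∅) ∨
        ((((G' i).sub (S i)).edges.card : ℤ) - 3 * (S i).card = -1 ∧
          ∃ j j', j ≠ j' ∧ ((G' i).sub (S i)).edges = {j, j'} ∧
            ((G' i).sub (S i)).specialLocus K =
              polyZeros (MvPolynomial.X j - MvPolynomial.X j')) ∨
        ((((G' i).sub (S i)).edges.card : ℤ) - 3 * (S i).card = 0 ∧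
          ((G' i).sub (S i)).edgeInjectivePoly K ((G' i).sub (S i)).edges ≠ 0 ∧
          ((G' i).sub (S i)).specialLocus K =
            polyZeros (((G' i).sub (S i)).edgeInjectivePoly K ((G' i).sub (S i)).edges)))) ∧
    -- the explicit polynomials for the last graph
    (3 * (G' k).faces.card ≤ ((G' k).edgesOn (G' k).faces).card →
      (G' k).specialLocus K =
        ⋂ C ∈ (G' k).edges.powersetCard (3 * (G' k).faces.card),
          polyZeros ((G' k).edgeInjectivePoly K C)) := by
  have h := PlaneGraph.isContractionSeq_faces k S G' hG' hmin hdisj hlast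
  have hE : ∀ i, (G' i).edges = G.edgesOf (G' i).faces := by
    subst hG'; exact G.edges_contractSeq S
  have hon : ∀ i T, (G' i).edgesOn T = G.edgesAt (G' i).faces T := fun i =>
    PlaneGraph.Minor.edgesOn_eq (hE i)
  have hsubM : ∀ i (a : E → K), (((G' i).sub (S i)).Mext a).rank =
      (G.labelMatrix a (S i) (G.edgesAt (G' i).faces (S i))).rank := fun i a => by
    rw [← hon]; rfl
  have hsubE : ∀ i, ((G' i).sub (S i)).edges = G.edgesAt (G' i).faces (S i) := fun i => hon i _
  have hM : ∀ i (a : E → K), ((G' i).Mext a).rank =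
      (G.labelMatrix a (G' i).faces (G.edgesOf (G' i).faces)).rank := fun i a => by
    rw [← hE]; rfl
  have hwhole : G.whole = G' 0 := by rw [hG']; rfl
  -- the three characterizations of special position
  have hsub : ∀ i < k, ∀ a : E → K, ((G' i).sub (S i)).InSpecialPosition a ↔
      (((G' i).sub (S i)).Mext a).rank < ((G' i).sub (S i)).edges.card := by
    intro i hi
    refine PlaneGraph.Minor.inSpecialPosition_iff _ (fun a => ?_) ?_
    · rw [hsubM, hsubE]
      exact G.rank_labelMatrix_le_edges _ _ _
    · obtain ⟨b, hb⟩ := h.exists_rank_ge (K := K) hshare hi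
      exact ⟨b, by rwa [hsubM, hsubE]⟩
  have hk : ∀ a : E → K, (G' k).InSpecialPosition a ↔ ((G' k).Mext a).rank <
      min ((G' k).edgesOn (G' k).faces).card (3 * (G' k).faces.card) := by
    refine PlaneGraph.Minor.inSpecialPosition_iff _ (fun a => ?_) ?_
    · rw [hM, hon]
      exact h.rank_last_edgesOf_le hshare a le_rfl
    · obtain ⟨b, hb⟩ := h.exists_rank_last_ge (K := K) hshare
      exact ⟨b, by rwa [hM, hon]⟩
  have h0 : ∀ a : E → K, G.whole.InSpecialPosition a ↔
      (G.labelMatrix a (G' 0).faces (G.edgesOf (G' 0).faces)).rank <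
        ∑ l ∈ Finset.Ico 0 k, (G.edgesAt (G' l).faces (S l)).card +
          min (G.edgesAt (G' k).faces (G' k).faces).card (3 * (G' k).faces.card) := by
    intro a
    rw [hwhole, ← hM]
    refine PlaneGraph.Minor.inSpecialPosition_iff _ (fun a => ?_) ?_ a
    · rw [hM]
      exact h.rank_remaining_edgesOf_le hshare a le_rfl (Nat.zero_le k)
    · obtain ⟨b, hb⟩ := h.exists_rank_whole_ge (K := K) hshare
      exact ⟨b, by rwa [hM]⟩
  have hsubL : ∀ i < k, ((G' i).sub (S i)).specialLocus K = {a |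
      (G.labelMatrix a (S i) (G.edgesAt (G' i).faces (S i))).rank <
        (G.edgesAt (G' i).faces (S i)).card} := by
    intro i hi
    ext a
    rw [Set.mem_ofPred_eq, ← hsubM, ← hsubE]
    exact hsub i hi a
  have hkL : (G' k).specialLocus K = {a |
      (G.labelMatrix a (G' k).faces (G.edgesOf (G' k).faces)).rank <
        min (G.edgesAt (G' k).faces (G' k).faces).card (3 * (G' k).faces.card)} := by
    ext a
    rw [Set.mem_ofPred_eq, ← hM, ← hon]
    exact hk a
  have h0L : G.whole.specialLocus K = {a |
      (G.labelMatrix a (G' 0).faces (G.edgesOf (G' 0).faces)).rank <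
        ∑ l ∈ Finset.Ico 0 k, (G.edgesAt (G' l).faces (S l)).card +
          min (G.edgesAt (G' k).faces (G' k).faces).card (3 * (G' k).faces.card)} :=
    Set.ext h0
  refine ⟨fun i hi => ⟨hsub i hi, ?_⟩, hk, ?_, ?_, ?_, fun i hi => ?_, fun hle => ?_⟩
  · rw [hsubL i hi]
    exact G.isAlgebraicVariety_rank_labelMatrix_lt _ _ _
  · rw [hkL]
    exact G.isAlgebraicVariety_rank_labelMatrix_lt _ _ _
  · ext a
    rw [h0L, hkL]
    simp only [Set.mem_union, Set.mem_iUnion, Set.mem_ofPred_eq, Set.mem_Iio]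
    rw [h.rank_lt_iff hshare a]
    refine or_congr (exists_congr fun i => ?_) Iff.rfl
    rw [exists_prop]
    refine and_congr_right fun hi => ?_
    rw [hsubL i hi]
    rfl
  · rw [h0L]
    exact G.isAlgebraicVariety_rank_labelMatrix_lt _ _ _
  · rw [hsubE i, hsubL i hi]
    rcases h.card_eq_or_singleton hshare hi with h1 | ⟨⟨f, hf⟩, h1 | h1⟩
    · right; right
      have heval := fun a : E → K => PlaneGraph.eval_edgeInjectivePoly_eq_zero_iff
        ((G' i).sub (S i)) (C := G.edgesAt (G' i).faces (S i)) h1 a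
      refine ⟨by rw [h1]; push_cast; ring, fun hp => ?_, ?_⟩
      -- Labels of full rank are not zeros, so the polynomial is nonzero.
      · obtain ⟨b, hb⟩ := h.exists_rank_ge (K := K) hshare hi
        refine absurd ((heval b).1 (by rw [hp, map_zero])) (not_lt.2 ?_)
        rwa [h1] at hb
      · ext a
        rw [h1]
        exact (heval a).symm
    · left
      obtain ⟨j, hj⟩ := Finset.card_eq_one.1 h1
      have hfj : j ∈ G.edgesAt (G' i).faces (S i) := by rw [hj]; simp
      obtain ⟨-, g, hg, hgj⟩ := PlaneGraph.mem_edgesAt.1 hfj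
      rw [hf, Finset.mem_singleton] at hg
      subst hg
      refine ⟨by rw [h1, hf]; simp, ⟨j, hj⟩, Set.eq_empty_of_forall_notMem fun a ha => ?_⟩
      rw [Set.mem_ofPred_eq, h1, hf] at ha
      exact absurd ha (not_lt.2 (PlaneGraph.rank_labelMatrix_singleton_pos a (hf ▸ hfj) hgj))
    · right; left
      obtain ⟨j, j', hjj, hj⟩ := Finset.card_eq_two.1 h1
      have hbd : ∀ e ∈ G.edgesAt (G' i).faces (S i), G.bd f e ≠ 0 := by
        intro e he
        obtain ⟨-, g, hg, hge⟩ := PlaneGraph.mem_edgesAt.1 he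
        rw [hf, Finset.mem_singleton] at hg
        exact hg ▸ hge
      refine ⟨by rw [h1, hf]; simp, j, j', hjj, hj, ?_⟩
      ext a
      have := PlaneGraph.rank_labelMatrix_singleton_lt_two_iff a (hbd j (by rw [hj]; simp))
        (hbd j' (by rw [hj]; simp)) (Ε := G.edgesAt (G' i).faces (S i)) (by simp [hj])
      rw [Set.mem_ofPred_eq, h1]
      simp only [polyZeros, Set.mem_ofPred_eq, map_sub, MvPolynomial.eval_X, sub_eq_zero]
      rw [← this, hf]
  · rw [hon] at hle
    rw [hkL, hE, min_eq_right hle]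
    ext a
    rw [Set.mem_ofPred_eq, G.rank_labelMatrix_lt_iff]
    simp only [Set.mem_iInter]
    refine forall₂_congr fun C hC => ?_
    exact (PlaneGraph.eval_edgeInjectivePoly_eq_zero_iff (G' k)
      (Finset.mem_powersetCard.1 hC).2 a).symm
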